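/- **Notation.** For $n=(n_1,\dots,n_d)$, $\mathbb C^{n_1\times\dots\times n_d}$ is the space of $d$-mode tensors with the Euclidean norm $\|\cdot\|$; $\bigcirc_{\ell=1}^d v^{(\ell)}$ is the rank-one tensor with entries $\prod_\ell v^{(\ell)}_{i_\ell}$; $Z\times_1A_1\cdots\times_dA_d$ is the tensor with entries $\sum_{k_1,\dots,k_d}\prod_\ell (A_\ell)_{i_\ell,k_\ell}\,Z_{k_1,\dots,k_d}$; and $\mathrm{vect}$ is the vectorization $\mathbb C^{m_1\times\dots\times m_d}\to\mathbb C^{\prod_\ell m_\ell}$. A matrix $A\in\mathbb C^{m\times n}$ is an $\epsilon$-JL embedding of $S\subset\mathbb C^n$ if for every $x\in S$ there is $\epsilon_x\in(-\epsilon,\epsilon)$ with $\|Ax\|_2^2=(1+\epsilon_x)\|x\|_2^2$. For $\eta\in(0,1/2)$ and $K>0$, a family $\{\mathcal D_{(m,n)}\}$ of probability distributions on $m\times n$ complex matrices is called $\eta$-optimal with constant $K$ if for all $\epsilon\in(0,1)$, all $m<n$ and all nonempty $S\subset\mathbb C^n$ with $|S|\le\eta\exp(\epsilon^2m/K)$,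 a matrix $A\sim\mathcal D_{(m,n)}$ is an $\epsilon$-JL embedding of $S$ with probability at least $1-\eta$. **Theorem.** There is an absolute constant $K>0$ such that for every $\eta\in(0,1/2)$ an $\eta$-optimal family with constant $K$ exists. Moreover, for every $K>0$ there are constants $C',C,\tilde C>0$, depending only on $K$, such that the following holds for all $\epsilon,\eta\in(0,1/2)$, $d\ge3$, $r\ge1$ and $n_1,\dots,n_d$. Put $n:=\max_jn_j$. Consider $r$-dimensional subspaces $\mathcal L\subset\mathbb C^{n_1\times\dots\times n_d}$ spanned by a basis of rank-one tensors $\bigcirc_{\ell=1}^d y_k^{(\ell)}$, $k=1,\dots,r$, with $\|y^{(\ell)}_k\|_2=1$ and with modewise coherence $$\mu_{\mathcal B}:=\max_{\ell}\max_{k\ne h}\bigl|\langle y_k^{(\ell)},y_h^{(\ell)}\rangle\bigr|\quad(\mu_{\mathcal B}:=0\text{ if }r=1)\qquad\text{satisfying}\qquad \mu_{\mathcal B}^{d-1}<\frac1{2r}.$$ For dimensions $m_\ell\le n_\ell$ and $m'\le\prod_\ell m_\ell$, draw independently $A_\ell\in\mathbb C^{m_\ell\times n_\ell}$ from any $(\eta/4d)$-optimal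 families ($\ell=1,\dots,d$) and $A\in\mathbb C^{m'\times\prod_\ell m_\ell}$ from any $(\eta/2)$-optimal family, all with constant $K$ (a matrix that would be square, so that it reduces no dimension, is taken to be the identity), and put $L(Z):=A\bigl(\mathrm{vect}(Z\times_1A_1\cdots\times_dA_d)\bigr)$. (i) If $n\ge4r+1$, there are dimensions $m_\ell\le n_\ell$ and $m'\le\prod_\ell m_\ell$, depending only on $K,\epsilon,\eta,d,r,n_1,\dots,n_d$, with $$m'\le C'\,r\,\epsilon^{-2}\ln\Bigl(\frac{47}{\epsilon\,\eta^{1/r}}\Bigr),\qquad m_\ell\le C\,\frac{rd^3}{\epsilon^2}\ln\Bigl(\frac n{\eta^{1/d}}\Bigr)\ (\ell=1,\dots,d),\qquad \prod_{\ell=1}^dm_\ell\le C^d\,\frac{r^dd^{3d}}{\epsilon^{2d}}\ln^d\Bigl(\frac n{\eta^{1/d}}\Bigr),$$ such that for all families and all $\mathcal L$ as above and every tensor $X\in\mathbb C^{n_1\times\dots\times n_d}$, with probability at least $1-\eta$, $$\bigl|\,\|L(X-Y)\|_2^2-\|X-Y\|^2\,\bigr|\le\epsilon\,\|X-Y\|^2\qquad\text{for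 all }Y\in\mathcal L.\tag{$*$}$$ (ii) (Also without the assumption $n\ge4r+1$.) There are dimensions $m_\ell\le n_\ell$ and $m'\le\prod_\ell m_\ell$, depending only on the same data, with the same bound on $m'$ and with $$m_\ell\le\tilde C\,r^{2/d}\Bigl(\frac d\epsilon\Bigr)^{2}\ln\Bigl(\frac{2r^2d}\eta\Bigr)\ (\ell=1,\dots,d),\qquad \prod_{\ell=1}^dm_\ell\le\tilde C^d\,r^2\Bigl(\frac d\epsilon\Bigr)^{2d}\ln^d\Bigl(\frac{2r^2d}\eta\Bigr),$$ such that for all families and all $\mathcal L$ as above and every $X\in\mathcal L$, $(*)$ holds with probability at least $1-\eta$. -/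

import Mathlib

open MeasureTheory

noncomputable section

/-- The `m × n` matrices carry the product (equivalently, Borel) σ-algebra. -/
instance Matrix.instMeasurableSpaceFinComplex (m n : ℕ) :
    MeasurableSpace (Matrix (Fin m) (Fin n) ℂ) :=
  inferInstanceAs (MeasurableSpace (Fin m → Fin n → ℂ))

instance Matrix.instBorelSpaceFinComplex (m n : ℕ) :
    BorelSpace (Matrix (Fin m) (Fin n) ℂ) :=
  inferInstanceAs (BorelSpace (Fin m → Fin n → ℂ))

namespace TensorJL

/-! ### Johnson–Lindenstrauss embeddings and optimal families -/

/-- `A` is an `ε`-JL embedding of the set `S`. -/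
def IsJLEmbedding (ε : ℝ) {m n : ℕ} (A : Matrix (Fin m) (Fin n) ℂ)
    (S : Set (EuclideanSpace ℂ (Fin n))) : Prop :=
  ∀ x ∈ S, ∃ e ∈ Set.Ioo (-ε) ε, ‖A.toEuclideanLin x‖ ^ 2 = (1 + e) * ‖x‖ ^ 2

/-- A family of measures, the `(m, n)`-th one on the `m × n` complex matrices. -/
abbrev MatrixLaws : Type := ∀ m n : ℕ, Measure (Matrix (Fin m) (Fin n) ℂ)

/-- `D` is an `η`-optimal family of JL embedding distributions with constant `K`. -/
structure IsOptimalJLFamily (η K : ℝ) (D : MatrixLaws) : Prop where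
  isProbabilityMeasure : ∀ m n : ℕ, IsProbabilityMeasure (D m n)
  jl : ∀ ε ∈ Set.Ioo (0 : ℝ) 1, ∀ m n : ℕ, m < n →
    ∀ S : Finset (EuclideanSpace ℂ (Fin n)), S.Nonempty →
      (S.card : ℝ) ≤ η * Real.exp (ε ^ 2 * m / K) →
        1 - η ≤ (D m n).real {A | IsJLEmbedding ε A (S : Set (EuclideanSpace ℂ (Fin n)))}

/-- The law of the `m × n` matrix (`m ≤ n`) used in a construction based on the family `D`: it is
drawn from `D m n` if it reduces the dimension, i.e. if `m < n`; for `m = n` it is the identity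
matrix, there being nothing to reduce. -/
def drawLaw (D : MatrixLaws) (m n : ℕ) : Measure (Matrix (Fin m) (Fin n) ℂ) :=
  if m < n then D m n
  else Measure.dirac (Matrix.of fun (i : Fin m) (j : Fin n) => if (i : ℕ) = (j : ℕ) then 1 else 0)

/-! ### Tensors -/

/-- The space `ℂ^{n₁ × ⋯ × n_d}` of `d`-mode tensors with its Euclidean norm. -/
abbrev Tensor {d : ℕ} (n : Fin d → ℕ) : Type := EuclideanSpace ℂ (∀ l : Fin d, Fin (n l))

/-- The rank-one tensor `v₁ ○ ⋯ ○ v_d`. -/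
def rankOne {d : ℕ} {n : Fin d → ℕ} (v : ∀ l : Fin d, EuclideanSpace ℂ (Fin (n l))) : Tensor n :=
  WithLp.toLp 2 fun i => ∏ l, v l (i l)

/-- The tensor `Z ×₁ A₁ ⋯ ×_d A_d`, where `×_j` is the `j`-mode product: its entry at
`(i₁, …, i_d)` is the sum over `(k₁, …, k_d)` of
`A₁(i₁, k₁) ⋯ A_d(i_d, k_d) Z(k₁, …, k_d)`. -/
def modeProducts {d : ℕ} {m n : Fin d → ℕ} (A : ∀ l : Fin d, Matrix (Fin (m l)) (Fin (n l)) ℂ)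
    (Z : Tensor n) : Tensor m :=
  WithLp.toLp 2 fun i => ∑ k : (∀ l : Fin d, Fin (n l)), (∏ l, A l (i l) (k l)) * Z k

/-- The vectorization `ℂ^{m₁ × ⋯ × m_d} → ℂ^{m₁ ⋯ m_d}`. -/
def vect {d : ℕ} {m : Fin d → ℕ} (Z : Tensor m) : EuclideanSpace ℂ (Fin (∏ l, m l)) :=
  WithLp.toLp 2 fun a => Z (finPiFinEquiv.symm a)

/-- The operator `L(Z) = A (vect (Z ×₁ A₁ ⋯ ×_d A_d))`. -/
def sketch {d : ℕ} {m n : Fin d → ℕ} {m' : ℕ}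
    (A : ∀ l : Fin d, Matrix (Fin (m l)) (Fin (n l)) ℂ)
    (A' : Matrix (Fin m') (Fin (∏ l, m l)) ℂ) (Z : Tensor n) : EuclideanSpace ℂ (Fin m') :=
  A'.toEuclideanLin (vect (modeProducts A Z))

/-- The maximum modewise coherence `max_l max_{k ≠ h} |⟨y_k^{(l)}, y_h^{(l)}⟩|`; it is `0` if there
is only one basis tensor. -/
def modewiseCoherence {d r : ℕ} {n : Fin d → ℕ}
    (y : ∀ l : Fin d, Fin r → EuclideanSpace ℂ (Fin (n l))) : ℝ :=
  sSup {t : ℝ | ∃ (l : Fin d) (k h : Fin r), k ≠ h ∧ t = ‖inner ℂ (y l k) (y l h)‖}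

/-- `y` gives a basis of rank-one tensors in standard form (all factors are unit vectors) with
modewise coherence satisfying `μ^{d-1} < 1/(2r)`. -/
structure IsIncoherentBasis {d r : ℕ} {n : Fin d → ℕ}
    (y : ∀ l : Fin d, Fin r → EuclideanSpace ℂ (Fin (n l))) : Prop where
  norm_eq_one : ∀ l k, ‖y l k‖ = 1
  linearIndependent : LinearIndependent ℂ fun k : Fin r => rankOne fun l => y l k
  coherence_lt : modewiseCoherence y ^ (d - 1) < 1 / (2 * (r : ℝ))

/-- The `r`-dimensional subspace spanned by the rank-one tensors given by `y`. -/
def spanOf {d r : ℕ} {n : Fin d → ℕ}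
    (y : ∀ l : Fin d, Fin r → EuclideanSpace ℂ (Fin (n l))) : Submodule ℂ (Tensor n) :=
  Submodule.span ℂ (Set.range fun k : Fin r => rankOne fun l => y l k)

/-- The joint law of the independent matrices `A₁, …, A_d` and `A`. -/
def sketchLaw {d : ℕ} (m n : Fin d → ℕ) (m' : ℕ) (D : Fin d → MatrixLaws) (D' : MatrixLaws) :
    Measure ((∀ l : Fin d, Matrix (Fin (m l)) (Fin (n l)) ℂ) ×
      Matrix (Fin m') (Fin (∏ l, m l)) ℂ) :=
  (Measure.pi fun l => drawLaw (D l) (m l) (n l)).prod (drawLaw D' m' (∏ l, m l))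

/-- The matrices for which `|‖L(X - Y)‖² - ‖X - Y‖²| ≤ ε ‖X - Y‖²` for all `Y` in `V`. -/
def goodEvent {d : ℕ} {n : Fin d → ℕ} (m : Fin d → ℕ) (m' : ℕ) (ε : ℝ) (X : Tensor n)
    (V : Submodule ℂ (Tensor n)) :
    Set ((∀ l : Fin d, Matrix (Fin (m l)) (Fin (n l)) ℂ) ×
      Matrix (Fin m') (Fin (∏ l, m l)) ℂ) :=
  {A | ∀ Y ∈ V, |‖sketch A.1 A.2 (X - Y)‖ ^ 2 - ‖X - Y‖ ^ 2| ≤ ε * ‖X - Y‖ ^ 2}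

end TensorJL

end

noncomputable section

namespace TensorJL

open ProbabilityTheory NNReal

/-! ### Existence of optimal families -/

/-! Optimal families come from Gaussian matrices: a Chernoff bound for the squared norm of one image
vector, then a union bound over the finite set (`exists_isOptimalJLFamily`).

For the sketch, everything is expressed through `gramDefect`, the change of inner products under a
linear map. Polarization bounds it by the relative errors at four points `u + i^s v`, so a JL
property on finitely many points controls inner products.

On the span of the basis, inner products of rank-one tensors factor over the modes, so it suffices
that each `A_l` almost preserves the inner products of the factors. The off-diagonal errors must be
smaller than the diagonal ones by a factor `r`. Writing `r = R ^ d` and giving one `R` to each mode,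
the incoherence condition yields `μ R ≤ 1`, and a per-mode error of order `ε / (d R)` is enough
(`nearIsometryAt_modeMap_of_incoherent`). This is the origin of `r ^ (2 / d)` in the second bound.

For arbitrary `X`, split `X = P + w` with `P` in the subspace and `w` orthogonal to it. One also has
to preserve the norm of `w` and its inner products with an orthonormal basis of the subspace, hence
the norms of at most `4 r + 1` fixed tensors. Norms of general tensors are preserved mode by mode,
by asking each matrix to preserve every fibre of the tensor already compressed in the earlier modes
(`nearIsometryAt_modeMap_of_fibers`). The Cauchy–Schwarz loss `√r` in the cross terms makes the
per-mode error of order `ε / (d √r)`, and the number of fibres puts `n` in the logarithm.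

The last matrix is independent of the others and acts on the image of an at most `(r +
1)`-dimensional space, where a net argument applies (`drawLaw_subspace_bad_le`).
`one_sub_le_sketchLaw_goodEvent` joins both stages, and the dimensions are then read off from the
cardinality conditions. -/

lemma integrable_and_integral_exp_mul_sq_gaussianReal (v : ℝ≥0) (t : ℝ) (h : |t * v| ≤ 1 / 4) :
    Integrable (fun x => Real.exp (t * x ^ 2)) (gaussianReal 0 v) ∧
      ∫ x, Real.exp (t * x ^ 2) ∂gaussianReal 0 v ≤ Real.exp (t * v + 4 * (t * v) ^ 2) := by
  rcases eq_or_ne v 0 with rfl | hv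
  · simp [gaussianReal_zero_var, integrable_dirac]
  have hv0 : (0 : ℝ) < v := by positivity
  have hb : 0 < 1 / (2 * (v : ℝ)) - t := by
    have : t * v < 1 / 2 := by linarith [(abs_le.1 h).2]
    rw [sub_pos, lt_div_iff₀ (by positivity)]; linarith
  have hpdf : ∀ x : ℝ, gaussianPDFReal 0 v x * Real.exp (t * x ^ 2) =
      (√(2 * Real.pi * v))⁻¹ * Real.exp (-(1 / (2 * (v : ℝ)) - t) * x ^ 2) := by
    intro x
    rw [gaussianPDFReal, mul_assoc, ← Real.exp_add]
    congr 2
    field_simp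
    ring
  constructor
  · rw [gaussianReal_of_var_ne_zero _ hv, integrable_withDensity_iff_integrable_smul'
      (measurable_gaussianPDF 0 v) (ae_of_all _ fun x => gaussianPDF_lt_top)]
    simp only [toReal_gaussianPDF, smul_eq_mul, hpdf]
    exact (integrable_exp_neg_mul_sq hb).const_mul _
  · rw [integral_gaussianReal_eq_integral_smul hv]
    simp only [smul_eq_mul, hpdf]
    rw [integral_const_mul, integral_gaussian, ← Real.sqrt_inv, ← Real.sqrt_mul (by positivity)]
    -- The moment generating function is `(1 - x) ^ (-1/2)`; for `|x| ≤ 1/2` the logarithmic series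
    -- gives `-log (1 - x) ≤ x + 2 x²`.
    set x := 2 * (t * v) with hx
    have hx2 : |x| ≤ 1 / 2 := by rw [hx, abs_mul, abs_two]; linarith
    have hx1 : 0 < 1 - x := by linarith [(abs_le.1 hx2).2]
    have e1 : (2 * Real.pi * (v : ℝ))⁻¹ * (Real.pi / (1 / (2 * (v : ℝ)) - t)) = (1 - x)⁻¹ := by
      have : 1 / (2 * (v : ℝ)) - t = (1 - x) / (2 * v) := by rw [hx]; field_simp
      rw [this]; field_simp
    rw [e1]
    have hlog := Real.abs_log_sub_add_sum_range_le (x := x) (by linarith) 1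
    simp only [Finset.range_one, Finset.sum_singleton, Nat.cast_zero, zero_add, pow_one, div_one]
      at hlog
    have h2 : |x| ^ (1 + 1) / (1 - |x|) ≤ 2 * x ^ 2 := by
      rw [div_le_iff₀ (by linarith), one_add_one_eq_two, sq_abs]
      nlinarith [sq_nonneg x]
    have h3 : -Real.log (1 - x) ≤ x + 2 * x ^ 2 := by linarith [(abs_le.1 (hlog.trans h2)).1]
    apply Real.sqrt_le_iff.2 ⟨(Real.exp_pos _).le, ?_⟩
    rw [← Real.exp_log (inv_pos.2 hx1), Real.log_inv, ← Real.exp_nat_mul]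
    apply Real.exp_le_exp.2
    push_cast
    nlinarith

lemma map_pi_gaussianReal_sum_mul {n : ℕ} (v : ℝ≥0) (u : Fin n → ℝ) :
    (Measure.pi fun _ : Fin n => gaussianReal 0 v).map (fun g => ∑ j, u j * g j) =
      gaussianReal 0 ((∑ j, u j ^ 2).toNNReal * v) := by
  have hs : ((∑ j, u j ^ 2).toNNReal : ℝ) = ∑ j, u j ^ 2 :=
    Real.coe_toNNReal _ (Finset.sum_nonneg fun _ _ => sq_nonneg _)
  have hm : Measurable fun g : Fin n → ℝ => ∑ j, u j * g j := by fun_prop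
  have : IsProbabilityMeasure ((Measure.pi fun _ : Fin n => gaussianReal 0 v).map
      (fun g => ∑ j, u j * g j)) := Measure.isProbabilityMeasure_map hm.aemeasurable
  apply Measure.ext_of_charFun
  ext t
  rw [charFun_gaussianReal, charFun_apply_real, integral_map hm.aemeasurable (by fun_prop)]
  have h1 : ∀ g : Fin n → ℝ, Complex.exp (t * ((∑ j, u j * g j : ℝ) : ℂ) * Complex.I) =
      ∏ j, Complex.exp (((t * u j : ℝ) : ℂ) * (g j) * Complex.I) := by
    intro g
    rw [← Complex.exp_sum]
    congr 1
    push_cast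
    rw [Finset.mul_sum, Finset.sum_mul]
    refine Finset.sum_congr rfl fun j _ => by ring
  simp_rw [h1]
  rw [integral_fintype_prod_eq_prod (𝕜 := ℂ)
    (f := fun j x => Complex.exp (((t * u j : ℝ) : ℂ) * (x : ℝ) * Complex.I))]
  simp_rw [← charFun_apply_real, charFun_gaussianReal]
  rw [← Complex.exp_sum]
  congr 1
  rw [NNReal.coe_mul, hs]
  push_cast
  simp only [mul_zero, zero_mul, zero_sub, Finset.sum_neg_distrib]
  rw [← Finset.sum_div]
  congr 2
  rw [Finset.sum_mul, Finset.sum_mul]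
  refine Finset.sum_congr rfl fun j _ => by ring

/-- The law of a real `m × n` matrix with independent centred Gaussian entries of variance
`1 / m`. -/
def gaussianEntries (m n : ℕ) : Measure (Fin m → Fin n → ℝ) :=
  Measure.pi fun _ => Measure.pi fun _ => gaussianReal 0 ((m : ℝ≥0)⁻¹)

instance (m n : ℕ) : IsProbabilityMeasure (gaussianEntries m n) := by
  unfold gaussianEntries; infer_instance

/-- The rows are independent, and each row pairs with `u` to a centred Gaussian of variance `‖u‖² /
m`, so the expectation is an `m`-th power. -/
lemma integrable_and_integral_exp_gaussianEntries {m n : ℕ} (hm : 0 < m) (u : Fin n → ℝ) (l : ℝ)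
    (hl : |l * ∑ j, u j ^ 2| ≤ 1 / 4) :
    Integrable (fun g => Real.exp (m * l * ∑ i, (∑ j, u j * g i j) ^ 2)) (gaussianEntries m n) ∧
      ∫ g, Real.exp (m * l * ∑ i, (∑ j, u j * g i j) ^ 2) ∂gaussianEntries m n ≤
        Real.exp (m * (l * (∑ j, u j ^ 2) + 4 * (l * ∑ j, u j ^ 2) ^ 2)) := by
  have hm0 : (0 : ℝ) < m := by exact_mod_cast hm
  have h1 : ∀ g : Fin m → Fin n → ℝ, Real.exp (m * l * ∑ i, (∑ j, u j * g i j) ^ 2) =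
      ∏ i, Real.exp (m * l * (∑ j, u j * g i j) ^ 2) := by
    intro g
    rw [← Real.exp_sum, Finset.mul_sum]
  simp_rw [h1]
  have hmeas : Measurable fun g : Fin n → ℝ => ∑ j, u j * g j := by fun_prop
  set w : ℝ≥0 := (∑ j, u j ^ 2).toNNReal * (m : ℝ≥0)⁻¹ with hw
  have hwv : m * l * (w : ℝ) = l * ∑ j, u j ^ 2 := by
    have : (w : ℝ) = (∑ j, u j ^ 2) * (m : ℝ)⁻¹ := by
      rw [hw, NNReal.coe_mul, Real.coe_toNNReal _ (Finset.sum_nonneg fun _ _ => sq_nonneg _),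
        NNReal.coe_inv, NNReal.coe_natCast]
    rw [this]; field_simp
  have key := integrable_and_integral_exp_mul_sq_gaussianReal w (m * l) (by rwa [hwv])
  rw [hwv, ← map_pi_gaussianReal_sum_mul] at key
  have hc : AEStronglyMeasurable (fun x : ℝ => Real.exp (m * l * x ^ 2))
      ((Measure.pi fun _ : Fin n => gaussianReal 0 ((m : ℝ≥0)⁻¹)).map
        (fun g => ∑ j, u j * g j)) := by fun_prop
  rw [integrable_map_measure hc hmeas.aemeasurable, integral_map hmeas.aemeasurable hc] at key
  constructor
  · exact Integrable.fintype_prod (f := fun _ (g : Fin n → ℝ) =>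
      Real.exp (m * l * (∑ j, u j * g j) ^ 2)) fun _ => key.1
  · rw [gaussianEntries, integral_fintype_prod_eq_prod (𝕜 := ℝ)
      (f := fun _ (g : Fin n → ℝ) => Real.exp (m * l * (∑ j, u j * g j) ^ 2))]
    rw [Finset.prod_const, Finset.card_univ, Fintype.card_fin, Real.exp_nat_mul]
    exact pow_le_pow_left₀ (integral_nonneg fun _ => (Real.exp_pos _).le) key.2 _

/-- Concentration of the squared norm of the image of a real vector. -/
lemma measure_gaussianEntries_abs_gt {m n : ℕ} (hm : 0 < m) (u : Fin n → ℝ) {ε : ℝ}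
    (h0 : 0 < ε) (h1 : ε < 1) :
    (gaussianEntries m n).real
      {g | ε * ∑ j, u j ^ 2 < |∑ i, (∑ j, u j * g i j) ^ 2 - ∑ j, u j ^ 2|} ≤
      2 * Real.exp (-(ε ^ 2 * m / 16)) := by
  have hm0 : (0 : ℝ) < m := by exact_mod_cast hm
  set s := ∑ j, u j ^ 2 with hs
  rcases (Finset.sum_nonneg fun j _ => sq_nonneg (u j) : 0 ≤ ∑ j, u j ^ 2).eq_or_lt with hs0 | hs0
  · have hu : ∀ j, u j = 0 := fun j => by
      have := (Finset.sum_eq_zero_iff_of_nonneg (fun j _ => sq_nonneg (u j))).1 hs0.symm j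
        (Finset.mem_univ _)
      simpa using this
    have : s = 0 := hs0.symm
    simp only [hu, this]
    simp
    positivity
  rw [← hs] at hs0
  have tail : ∀ σ : ℝ, |σ| = 1 → (gaussianEntries m n).real
      {g | ε * s ≤ σ * (∑ i, (∑ j, u j * g i j) ^ 2 - s)} ≤ Real.exp (-(ε ^ 2 * m / 16)) := by
    intro σ hσ
    have hσ2 : σ ^ 2 = 1 := by rw [← sq_abs, hσ, one_pow]
    -- Chernoff parameter: with `l s = σ ε / 8` the exponent is `m (σ ε / 8 + 4 ε² / 64)` against
    -- the threshold `m (σ ε / 8 + ε² / 8)`, leaving `-m ε² / 16`.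
    set l := σ * ε / (8 * s) with hl
    have hls : l * s = σ * ε / 8 := by rw [hl]; field_simp
    have hk := integrable_and_integral_exp_gaussianEntries (n := n) hm u l (by
      rw [← hs, hls, abs_div, abs_mul, hσ, abs_of_pos h0]; norm_num; linarith)
    rw [← hs, hls] at hk
    have hmk := mul_meas_ge_le_integral_of_nonneg (ae_of_all _ fun g => (Real.exp_pos _).le) hk.1
      (Real.exp (m * (σ * ε / 8 + ε ^ 2 / 8)))
    have hsub : {g : Fin m → Fin n → ℝ | ε * s ≤ σ * (∑ i, (∑ j, u j * g i j) ^ 2 - s)} ⊆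
        {g | Real.exp (m * (σ * ε / 8 + ε ^ 2 / 8)) ≤
          Real.exp (m * l * ∑ i, (∑ j, u j * g i j) ^ 2)} := by
      intro g hg
      simp only [Set.mem_ofPred_eq] at hg ⊢
      apply Real.exp_le_exp.2
      rw [mul_assoc]
      apply mul_le_mul_of_nonneg_left _ hm0.le
      set q := ∑ i, (∑ j, u j * g i j) ^ 2
      have : l * q = ε / (8 * s) * (σ * (q - s)) + σ * ε / 8 := by rw [hl]; field_simp; ring
      rw [this]
      have h2 := mul_le_mul_of_nonneg_left hg (show 0 ≤ ε / (8 * s) by positivity)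
      have h3 : ε / (8 * s) * (ε * s) = ε ^ 2 / 8 := by field_simp
      linarith
    have h4 := (mul_le_mul_of_nonneg_left (measureReal_mono hsub (μ := gaussianEntries m n))
      (Real.exp_pos (m * (σ * ε / 8 + ε ^ 2 / 8))).le).trans (hmk.trans hk.2)
    rw [← le_div_iff₀' (Real.exp_pos _), ← Real.exp_sub] at h4
    refine h4.trans (Real.exp_le_exp.2 (le_of_eq ?_))
    have : (σ * ε / 8) ^ 2 = ε ^ 2 / 64 := by rw [div_pow, mul_pow, hσ2]; ring
    rw [this]; ring
  have hsub : {g : Fin m → Fin n → ℝ | ε * s < |∑ i, (∑ j, u j * g i j) ^ 2 - s|} ⊆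
      {g | ε * s ≤ 1 * (∑ i, (∑ j, u j * g i j) ^ 2 - s)} ∪
        {g | ε * s ≤ (-1) * (∑ i, (∑ j, u j * g i j) ^ 2 - s)} := by
    intro g hg
    simp only [Set.mem_ofPred_eq, Set.mem_union] at hg ⊢
    rcases lt_abs.1 hg with h | h
    · left; linarith
    · right; linarith
  calc _ ≤ _ := measureReal_mono hsub
    _ ≤ _ := measureReal_union_le _ _
    _ ≤ _ := by linarith [tail 1 (by simp), tail (-1) (by simp)]

/-- The Gaussian laws with variance `1 / m`. -/
def gaussianLaws : MatrixLaws := fun m n =>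
  (gaussianEntries m n).map fun g => Matrix.of fun i j => (g i j : ℂ)

lemma measurable_ofReal_entries (m n : ℕ) : Measurable
    (fun g : Fin m → Fin n → ℝ => (Matrix.of fun i j => (g i j : ℂ) : Matrix (Fin m) (Fin n) ℂ)) := by
  refine measurable_pi_lambda _ fun i => measurable_pi_lambda _ fun j => ?_
  exact Complex.measurable_ofReal.comp ((measurable_pi_apply j).comp (measurable_pi_apply i))

lemma norm_sq_toEuclideanLin_ofReal {m n : ℕ} (g : Fin m → Fin n → ℝ)
    (x : EuclideanSpace ℂ (Fin n)) :
    ‖(Matrix.of fun i j => (g i j : ℂ) : Matrix (Fin m) (Fin n) ℂ).toEuclideanLin x‖ ^ 2 =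
      ∑ i, (∑ j, (x j).re * g i j) ^ 2 + ∑ i, (∑ j, (x j).im * g i j) ^ 2 := by
  rw [EuclideanSpace.norm_sq_eq, ← Finset.sum_add_distrib]
  refine Finset.sum_congr rfl fun i _ => ?_
  rw [← Complex.normSq_eq_norm_sq, Complex.normSq_apply, ← sq, ← sq]
  congr 2
  all_goals
    simp [Matrix.toLpLin_apply, Matrix.mulVec, dotProduct, mul_comm]

theorem exists_isOptimalJLFamily :
    ∃ K : ℝ, 0 < K ∧ ∀ η ∈ Set.Ioo (0 : ℝ) (1 / 2), ∃ D : MatrixLaws, IsOptimalJLFamily η K D := by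
  -- `192 = 3 · 64`: real and imaginary parts, each with error `ε / 2`, fail with total probability
  -- at most `4 exp (-ε² m / 64) = 4 E⁻³` for `E = exp (ε² m / 192)`. With at most `η E` vectors
  -- this sums to `4 η / E² ≤ η` as soon as `E ≥ 2`.
  refine ⟨192, by norm_num, fun η hη => ⟨gaussianLaws, ⟨fun m n => ?_, ?_⟩⟩⟩
  · exact Measure.isProbabilityMeasure_map (measurable_ofReal_entries m n).aemeasurable
  intro ε hε m n hmn S hS hcard
  have hprob : IsProbabilityMeasure (gaussianLaws m n) :=
    Measure.isProbabilityMeasure_map (measurable_ofReal_entries m n).aemeasurable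
  have hS1 : (1 : ℝ) ≤ S.card := by exact_mod_cast hS.card_pos
  -- Since `S` is nonempty, `1 ≤ η E`, and `η < 1/2`; this also excludes `m = 0`.
  have hexp : 2 ≤ Real.exp (ε ^ 2 * m / 192) := by
    by_contra h
    push Not at h
    have := mul_lt_mul_of_pos_left h hη.1
    linarith [hη.2]
  have hm : 0 < m := by
    rcases Nat.eq_zero_or_pos m with rfl | h
    · norm_num at hexp
    · exact h
  set T : EuclideanSpace ℂ (Fin n) → Set (Fin m → Fin n → ℝ) := fun x =>
    {g | ε / 2 * ∑ j, (x j).re ^ 2 < |∑ i, (∑ j, (x j).re * g i j) ^ 2 - ∑ j, (x j).re ^ 2|} ∪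
    {g | ε / 2 * ∑ j, (x j).im ^ 2 < |∑ i, (∑ j, (x j).im * g i j) ^ 2 - ∑ j, (x j).im ^ 2|} with hT
  have hTm : ∀ x, MeasurableSet (T x) := by
    intro x
    apply MeasurableSet.union
    all_goals exact measurableSet_lt (by fun_prop) (by fun_prop)
  have hTP : ∀ x, (gaussianEntries m n).real (T x) ≤ 4 * Real.exp (-(ε ^ 2 * m / 64)) := by
    intro x
    have h1 := measure_gaussianEntries_abs_gt hm (fun j => (x j).re) (ε := ε / 2)
      (by linarith [hε.1]) (by linarith [hε.2])
    have h2 := measure_gaussianEntries_abs_gt hm (fun j => (x j).im) (ε := ε / 2)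
      (by linarith [hε.1]) (by linarith [hε.2])
    have e : (ε / 2) ^ 2 * (m : ℝ) / 16 = ε ^ 2 * m / 64 := by ring
    rw [e] at h1 h2
    exact (measureReal_union_le _ _).trans (by linarith)
  have hgood : (⋃ x ∈ S, T x)ᶜ ⊆ (fun g => Matrix.of fun i j => ((g i j : ℝ) : ℂ)) ⁻¹'
      {A | IsJLEmbedding ε A (S : Set (EuclideanSpace ℂ (Fin n)))} := by
    intro g hg x hx
    have hgx : g ∉ T x := fun h => hg (Set.mem_biUnion (by exact_mod_cast hx) h)
    simp only [hT, Set.mem_union, Set.mem_ofPred_eq, not_or, not_lt] at hgx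
    rw [norm_sq_toEuclideanLin_ofReal]
    have hnx : ‖x‖ ^ 2 = ∑ j, (x j).re ^ 2 + ∑ j, (x j).im ^ 2 := by
      rw [EuclideanSpace.norm_sq_eq, ← Finset.sum_add_distrib]
      refine Finset.sum_congr rfl fun i _ => ?_
      rw [← Complex.normSq_eq_norm_sq, Complex.normSq_apply, ← sq, ← sq]
    rcases eq_or_ne x 0 with rfl | hx0
    · exact ⟨0, ⟨by linarith [hε.1], hε.1⟩, by simp⟩
    have hpos : 0 < ‖x‖ ^ 2 := by have := norm_pos_iff.2 hx0; positivity
    set q := ∑ i, (∑ j, (x j).re * g i j) ^ 2 + ∑ i, (∑ j, (x j).im * g i j) ^ 2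
    have hq : |q - ‖x‖ ^ 2| ≤ ε / 2 * ‖x‖ ^ 2 := by
      obtain ⟨⟨a1, a2⟩, ⟨b1, b2⟩⟩ := hgx.imp abs_le.1 abs_le.1
      rw [hnx]
      exact abs_le.2 ⟨by simp only [q]; linarith, by simp only [q]; linarith⟩
    refine ⟨(q - ‖x‖ ^ 2) / ‖x‖ ^ 2, abs_lt.1 ?_, by field_simp; ring⟩
    rw [abs_div, abs_of_pos hpos, div_lt_iff₀ hpos]
    nlinarith [hε.1]
  have hbad : (gaussianEntries m n).real (⋃ x ∈ S, T x) ≤ η := by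
    refine (measureReal_biUnion_finset_le S T).trans ((Finset.sum_le_sum fun x _ => hTP x).trans ?_)
    rw [Finset.sum_const, nsmul_eq_mul]
    set E := Real.exp (ε ^ 2 * m / 192)
    have hE : Real.exp (-(ε ^ 2 * m / 64)) = (E ^ 3)⁻¹ := by
      rw [← Real.exp_nat_mul, ← Real.exp_neg]; congr 1; push_cast; ring
    rw [hE]
    have hE0 : 0 < E := Real.exp_pos _
    calc (S.card : ℝ) * (4 * (E ^ 3)⁻¹) ≤ (η * E) * (4 * (E ^ 3)⁻¹) := by gcongr
      _ = η * (4 / E ^ 2) := by field_simp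
      _ ≤ η * 1 := by
        apply mul_le_mul_of_nonneg_left _ hη.1.le
        rw [div_le_one (by positivity)]; nlinarith
      _ = η := mul_one _
  calc 1 - η ≤ (gaussianEntries m n).real (⋃ x ∈ S, T x)ᶜ := by
        rw [probReal_compl_eq_one_sub (S.measurableSet_biUnion fun x _ => hTm x)]; linarith
    _ ≤ (gaussianEntries m n).real ((fun g => Matrix.of fun i j => ((g i j : ℝ) : ℂ)) ⁻¹'
      {A | IsJLEmbedding ε A (S : Set (EuclideanSpace ℂ (Fin n)))}) := measureReal_mono hgood
    _ ≤ _ := by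
        -- Only an inequality for the image measure is needed, so the JL event need not be shown
        -- measurable.
        refine ENNReal.toReal_mono (measure_ne_top _ _) ?_
        exact Measure.le_map_apply (measurable_ofReal_entries m n).aemeasurable _

/-! ### The defect of a linear map from being an isometry -/

section GramDefect

variable {E F : Type*} [NormedAddCommGroup E] [InnerProductSpace ℂ E]
  [NormedAddCommGroup F] [InnerProductSpace ℂ F]

/-- The change of inner products under the linear map `T`. -/
def gramDefect (T : E →ₗ[ℂ] F) (u v : E) : ℂ := inner ℂ (T u) (T v) - inner ℂ u v

lemma norm_gramDefect_self (T : E →ₗ[ℂ] F) (u : E) :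
    ‖gramDefect T u u‖ = |‖T u‖ ^ 2 - ‖u‖ ^ 2| := by
  rw [gramDefect, inner_self_eq_norm_sq_to_K, inner_self_eq_norm_sq_to_K, ← Real.norm_eq_abs,
    ← Complex.norm_real]
  simp

lemma gramDefect_comm (T : E →ₗ[ℂ] F) (u v : E) :
    ‖gramDefect T u v‖ = ‖gramDefect T v u‖ := by
  rw [gramDefect, gramDefect, ← inner_conj_symm, ← inner_conj_symm u v, ← map_sub,
    RCLike.norm_conj]

/-- `gramDefect T u` as a linear form. -/
def gramDefectForm (T : E →ₗ[ℂ] F) (u : E) : E →ₗ[ℂ] ℂ :=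
  (innerₛₗ ℂ (T u)).comp T - innerₛₗ ℂ u

lemma gramDefect_add_right (T : E →ₗ[ℂ] F) (u v w : E) :
    gramDefect T u (v + w) = gramDefect T u v + gramDefect T u w :=
  map_add (gramDefectForm T u) v w

lemma gramDefect_smul_right (T : E →ₗ[ℂ] F) (u v : E) (c : ℂ) :
    gramDefect T u (c • v) = c * gramDefect T u v :=
  map_smul (gramDefectForm T u) c v

lemma gramDefect_sum_right {ι : Type*} (s : Finset ι) (T : E →ₗ[ℂ] F) (u : E) (v : ι → E) :
    gramDefect T u (∑ k ∈ s, v k) = ∑ k ∈ s, gramDefect T u (v k) :=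
  map_sum (gramDefectForm T u) v s

lemma gramDefect_add_left (T : E →ₗ[ℂ] F) (u v w : E) :
    gramDefect T (u + v) w = gramDefect T u w + gramDefect T v w := by
  simp only [gramDefect, map_add, inner_add_left]; ring

lemma gramDefect_smul_left (T : E →ₗ[ℂ] F) (u v : E) (c : ℂ) :
    gramDefect T (c • u) v = starRingEnd ℂ c * gramDefect T u v := by
  simp only [gramDefect, map_smul, inner_smul_left]; ring

lemma gramDefect_sum_left {ι : Type*} (s : Finset ι) (T : E →ₗ[ℂ] F) (u : ι → E) (v : E) :
    gramDefect T (∑ k ∈ s, u k) v = ∑ k ∈ s, gramDefect T (u k) v := by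
  simp only [gramDefect, map_sum, sum_inner, Finset.sum_sub_distrib]

/-- The linear map `T` preserves the squared norm of `x` up to the relative error `ε`. -/
def NearIsometryAt (T : E →ₗ[ℂ] F) (ε : ℝ) (x : E) : Prop :=
  |‖T x‖ ^ 2 - ‖x‖ ^ 2| ≤ ε * ‖x‖ ^ 2

/-- Polarization. -/
lemma norm_gramDefect_le (T : E →ₗ[ℂ] F) {ε : ℝ} (u v : E)
    (h : ∀ s : Fin 4, NearIsometryAt T ε (u + Complex.I ^ (s : ℕ) • v)) :
    ‖gramDefect T u v‖ ≤ ε * (‖u‖ ^ 2 + ‖v‖ ^ 2) := by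
  set f : E → ℝ := fun x => ‖T x‖ ^ 2 - ‖x‖ ^ 2 with hf
  have e0 : |f (u + v)| ≤ ε * ‖u + v‖ ^ 2 := by simpa [NearIsometryAt, hf] using h 0
  have e1 : |f (u + Complex.I • v)| ≤ ε * ‖u + Complex.I • v‖ ^ 2 := by
    simpa [NearIsometryAt, hf] using h 1
  have e2 : |f (u - v)| ≤ ε * ‖u - v‖ ^ 2 := by
    simpa [NearIsometryAt, hf, sub_eq_add_neg] using h 2
  have e3 : |f (u - Complex.I • v)| ≤ ε * ‖u - Complex.I • v‖ ^ 2 := by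
    have := h 3
    have hI : Complex.I ^ ((3 : Fin 4) : ℕ) = -Complex.I := by
      rw [show ((3 : Fin 4) : ℕ) = 3 from rfl, Complex.I_pow_three]
    rw [hI, neg_smul, ← sub_eq_add_neg] at this
    exact this
  -- The four error terms pair up by the parallelogram law into `4 (‖u‖² + ‖v‖²)`, which cancels the
  -- `4` of the polarization identity.
  have hp1 : ‖u + v‖ ^ 2 + ‖u - v‖ ^ 2 = 2 * (‖u‖ ^ 2 + ‖v‖ ^ 2) := by
    have := parallelogram_law_with_norm ℂ u v
    linarith
  have hp2 : ‖u + Complex.I • v‖ ^ 2 + ‖u - Complex.I • v‖ ^ 2 = 2 * (‖u‖ ^ 2 + ‖v‖ ^ 2) := by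
    have := parallelogram_law_with_norm ℂ u (Complex.I • v)
    rw [norm_smul, Complex.norm_I, one_mul] at this
    linarith
  have hg : gramDefect T u v = (((f (u + v) : ℝ) : ℂ) - (f (u - v) : ℝ) +
      ((f (u - Complex.I • v) : ℝ) - (f (u + Complex.I • v) : ℝ)) * Complex.I) / 4 := by
    rw [gramDefect, inner_eq_sum_norm_sq_div_four, inner_eq_sum_norm_sq_div_four u v]
    simp only [hf, map_add, map_sub, map_smul]
    push_cast
    simp only [RCLike.I_to_complex, Complex.coe_algebraMap]
    ring
  rw [hg, norm_div]
  have h4 : ‖(4 : ℂ)‖ = 4 := by simp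
  rw [h4, div_le_iff₀ (by norm_num)]
  refine (norm_add_le _ _).trans ?_
  rw [norm_mul, Complex.norm_I, mul_one]
  have n1 := norm_sub_le ((f (u + v) : ℝ) : ℂ) (f (u - v) : ℝ)
  have n2 := norm_sub_le ((f (u - Complex.I • v) : ℝ) : ℂ) (f (u + Complex.I • v) : ℝ)
  simp only [Complex.norm_real, Real.norm_eq_abs] at n1 n2
  have : ε * (‖u + v‖ ^ 2 + ‖u - v‖ ^ 2) + ε * (‖u + Complex.I • v‖ ^ 2 + ‖u - Complex.I • v‖ ^ 2)
    = ε * (‖u‖ ^ 2 + ‖v‖ ^ 2) * 4 := by rw [hp1, hp2]; ring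
  linarith

/-- The part bounded by `b` contributes `b (∑ |α k|)²`, and Cauchy–Schwarz costs a factor `r`. -/
lemma norm_sum_sum_conj_mul_le {r : ℕ} (α : Fin r → ℂ) (c : Fin r → Fin r → ℂ) {a b : ℝ}
    (hb : 0 ≤ b) (hc : ∀ k h, ‖c k h‖ ≤ (if k = h then a else 0) + b) :
    ‖∑ k, ∑ h, starRingEnd ℂ (α k) * (α h * c k h)‖ ≤ (a + r * b) * ∑ k, ‖α k‖ ^ 2 := by
  calc ‖∑ k, ∑ h, starRingEnd ℂ (α k) * (α h * c k h)‖
      ≤ ∑ k, ∑ h, ‖α k‖ * (‖α h‖ * ((if k = h then a else 0) + b)) := by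
        refine (norm_sum_le _ _).trans (Finset.sum_le_sum fun k _ => ?_)
        refine (norm_sum_le _ _).trans (Finset.sum_le_sum fun h _ => ?_)
        rw [norm_mul, norm_mul, RCLike.norm_conj]
        gcongr
        exact hc k h
    _ = a * ∑ k, ‖α k‖ ^ 2 + b * (∑ k, ‖α k‖) ^ 2 := by
        simp only [mul_add, Finset.sum_add_distrib]
        congr 1
        · simp only [mul_ite, mul_zero, Finset.sum_ite_eq, Finset.mem_univ, if_true, Finset.mul_sum]
          exact Finset.sum_congr rfl fun k _ => by ring
        · rw [sq, Finset.sum_mul_sum, Finset.mul_sum]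
          refine Finset.sum_congr rfl fun k _ => ?_
          rw [Finset.mul_sum]
          exact Finset.sum_congr rfl fun h _ => by ring
    _ ≤ a * ∑ k, ‖α k‖ ^ 2 + b * (r * ∑ k, ‖α k‖ ^ 2) := by
        have := sq_sum_le_card_mul_sum_sq (s := Finset.univ) (f := fun k => ‖α k‖)
        rw [Finset.card_univ, Fintype.card_fin] at this
        gcongr
    _ = _ := by ring

lemma sum_sum_conj_mul_inner_sub {r : ℕ} (α : Fin r → ℂ) (e : Fin r → E) :
    ∑ k, ∑ h, starRingEnd ℂ (α k) * (α h * (inner ℂ (e k) (e h) - if k = h then 1 else 0)) =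
      ((‖∑ k, α k • e k‖ ^ 2 - ∑ k, ‖α k‖ ^ 2 : ℝ) : ℂ) := by
  have h1 : ((‖∑ k, α k • e k‖ : ℂ)) ^ 2 =
      ∑ k, ∑ h, starRingEnd ℂ (α k) * (α h * inner ℂ (e k) (e h)) := by
    rw [← Complex.coe_algebraMap, ← inner_self_eq_norm_sq_to_K (𝕜 := ℂ), sum_inner]
    refine Finset.sum_congr rfl fun k _ => ?_
    rw [inner_sum]
    refine Finset.sum_congr rfl fun h _ => ?_
    rw [inner_smul_left, inner_smul_right]
  rw [Complex.ofReal_sub, Complex.ofReal_pow, h1, Complex.ofReal_sum, ← Finset.sum_sub_distrib]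
  refine Finset.sum_congr rfl fun k _ => ?_
  simp only [mul_sub, Finset.sum_sub_distrib, mul_ite, mul_one, mul_zero, Finset.sum_ite_eq,
    Finset.mem_univ, if_true]
  rw [Complex.conj_mul', Complex.ofReal_pow]

/-- If `T` almost preserves the Gram matrix of a nearly orthonormal family, it is nearly
isometric on its span. -/
lemma nearIsometryAt_of_mem_span {r : ℕ} (T : E →ₗ[ℂ] F) (e : Fin r → E) {G D : ℝ} (hr : 1 ≤ r)
    (hG : 0 ≤ G) (hD : 0 ≤ D)
    (hnorm : ∀ k, ‖e k‖ = 1) (hinner : ∀ k h, k ≠ h → ‖inner ℂ (e k) (e h)‖ ≤ G)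
    (hrG : r * G ≤ 1 / 2) (hdiag : ∀ k, ‖gramDefect T (e k) (e k)‖ ≤ D)
    (hoff : ∀ k h, k ≠ h → r * ‖gramDefect T (e k) (e h)‖ ≤ D)
    {Z : E} (hZ : Z ∈ Submodule.span ℂ (Set.range e)) : NearIsometryAt T (4 * D) Z := by
  obtain ⟨α, rfl⟩ := (Submodule.mem_span_range_iff_exists_fun ℂ).1 hZ
  have hr0 : (0 : ℝ) < r := by exact_mod_cast hr
  -- Diagonal errors `D` and off-diagonal errors `D / r` give a form of size `2 D` relative to `∑ |α
  -- k|²`.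
  have h1 : ‖gramDefect T (∑ k, α k • e k) (∑ k, α k • e k)‖ ≤
      (D + r * (D / r)) * ∑ k, ‖α k‖ ^ 2 := by
    have := norm_sum_sum_conj_mul_le α (fun k h => gramDefect T (e k) (e h)) (a := D)
      (b := D / r) (by positivity) (fun k h => by
        split_ifs with hkh
        · rw [hkh]; exact (hdiag h).trans (le_add_of_nonneg_right (by positivity))
        · rw [zero_add, le_div_iff₀' hr0]; exact hoff k h hkh)
    convert this using 2
    rw [gramDefect_sum_left]
    refine Finset.sum_congr rfl fun k _ => ?_
    rw [gramDefect_sum_right]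
    refine Finset.sum_congr rfl fun h _ => ?_
    rw [gramDefect_smul_left, gramDefect_smul_right]
  have h2 : ‖∑ k, ∑ h, starRingEnd ℂ (α k) *
      (α h * (inner ℂ (e k) (e h) - if k = h then 1 else 0))‖ ≤
      (0 + r * G) * ∑ k, ‖α k‖ ^ 2 := by
    refine norm_sum_sum_conj_mul_le α _ hG fun k h => ?_
    split_ifs with hkh
    · subst hkh
      rw [inner_self_eq_norm_sq_to_K, hnorm]
      simpa using hG
    · simpa using hinner k h hkh
  have h3 := sum_sum_conj_mul_inner_sub α e
  rw [h3, Complex.norm_real, Real.norm_eq_abs, zero_add] at h2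
  have hS : 0 ≤ ∑ k, ‖α k‖ ^ 2 := Finset.sum_nonneg fun _ _ => sq_nonneg _
  -- The Gram matrix is within `r G ≤ 1/2` of the identity, so the coefficients cost another factor
  -- `2`.
  have h4 : ∑ k, ‖α k‖ ^ 2 ≤ 2 * ‖∑ k, α k • e k‖ ^ 2 := by
    have := (abs_le.1 h2).1
    nlinarith
  rw [norm_gramDefect_self, mul_div_cancel₀ _ hr0.ne'] at h1
  refine h1.trans ?_
  nlinarith

/-- A form that is small on an orthonormal family is small on its span. -/
lemma norm_gramDefect_sum_le {ι : Type*} [Fintype ι] (T : E →ₗ[ℂ] F) (w : E)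
    (c : ι → ℂ) (e : ι → E) {τ : ℝ} (he : ∀ k, ‖gramDefect T w (e k)‖ ≤ τ) (hτ : 0 ≤ τ) :
    ‖gramDefect T w (∑ k, c k • e k)‖ ≤
      τ * (√(Fintype.card ι) * √(∑ k, ‖c k‖ ^ 2)) := by
  rw [gramDefect_sum_right]
  calc _ ≤ ∑ k, ‖c k‖ * τ := by
        refine (norm_sum_le _ _).trans (Finset.sum_le_sum fun k _ => ?_)
        rw [gramDefect_smul_right, norm_mul]
        gcongr
        exact he k
    _ = τ * ∑ k, ‖c k‖ := by rw [← Finset.sum_mul, mul_comm]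
    _ ≤ _ := by
        gcongr
        rw [← Real.sqrt_mul (Nat.cast_nonneg _)]
        apply Real.le_sqrt_of_sq_le
        have := sq_sum_le_card_mul_sum_sq (s := Finset.univ) (f := fun k => ‖c k‖)
        rwa [Finset.card_univ] at this

end GramDefect

/-! ### Nets -/

/-- A maximal `1`-separated subset of the ball of radius `2` is a `1`-net of that ball; it is
rescaled by `1/2`. Volume comparison bounds separated sets by `5` to the real dimension, that is
`25` to the complex dimension. -/
lemma exists_finset_net (V : Type*) [NormedAddCommGroup V] [NormedSpace ℂ V]
    [FiniteDimensional ℂ V] : ∃ s : Finset V, s.card ≤ 25 ^ Module.finrank ℂ V ∧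
      (∀ p ∈ s, ‖p‖ ≤ 1) ∧ ∀ x : V, ‖x‖ ≤ 1 → ∃ p ∈ s, ‖x - p‖ ≤ 1 / 2 := by
  classical
  have : FiniteDimensional ℝ V := FiniteDimensional.complexToReal V
  set P : Finset V → Prop := fun s => (∀ c ∈ s, ‖c‖ ≤ 2) ∧
    ∀ c ∈ s, ∀ d ∈ s, c ≠ d → 1 ≤ ‖c - d‖ with hP
  have hcard : ∀ s, P s → s.card ≤ 25 ^ Module.finrank ℂ V := fun s hs => by
    have := Besicovitch.card_le_of_separated s hs.1 hs.2
    rwa [finrank_real_of_complex, pow_mul] at this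
  have hne : {k | ∃ s, P s ∧ s.card = k}.Nonempty := ⟨0, ∅, by simp [hP], by simp⟩
  have hbdd : BddAbove {k | ∃ s, P s ∧ s.card = k} :=
    ⟨_, by rintro _ ⟨s, hs, rfl⟩; exact hcard s hs⟩
  obtain ⟨s, hs, hmax⟩ := Nat.sSup_mem hne hbdd
  refine ⟨s.image fun p => (1 / 2 : ℂ) • p, Finset.card_image_le.trans (hcard s hs), ?_, ?_⟩
  · intro p hp
    obtain ⟨q, hq, rfl⟩ := Finset.mem_image.1 hp
    rw [norm_smul]
    norm_num
    linarith [hs.1 q hq]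
  · intro x hx
    have h2x : ‖(2 : ℂ) • x‖ ≤ 2 := by rw [norm_smul]; norm_num; exact hx
    suffices ∃ q ∈ s, ‖(2 : ℂ) • x - q‖ ≤ 1 by
      obtain ⟨q, hq, hxq⟩ := this
      refine ⟨_, Finset.mem_image_of_mem _ hq, ?_⟩
      have : x - (1 / 2 : ℂ) • q = (1 / 2 : ℂ) • ((2 : ℂ) • x - q) := by
        rw [smul_sub, smul_smul]; norm_num
      rw [this, norm_smul]
      norm_num
      exact hxq
    by_contra! hcon
    have hnot : (2 : ℂ) • x ∉ s := fun h => by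
      have := hcon _ h
      simp at this
      linarith
    have hP' : P (insert ((2 : ℂ) • x) s) := by
      constructor
      · intro c hc
        rcases Finset.mem_insert.1 hc with rfl | hc
        · exact h2x
        · exact hs.1 c hc
      · intro c hc d hd hcd
        rcases Finset.mem_insert.1 hc with rfl | hc <;> rcases Finset.mem_insert.1 hd with rfl | hd
        · exact absurd rfl hcd
        · exact (hcon d hd).le
        · rw [norm_sub_rev]; exact (hcon c hc).le
        · exact hs.2 c hc d hd hcd
    have := le_csSup hbdd ⟨_, hP', rfl⟩
    rw [Finset.card_insert_of_notMem hnot, ← hmax] at this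
    omega

/-- Approximating a unit vector by the net gives `‖φ‖ ≤ β + ‖φ‖ / 2`. -/
lemma opNorm_le_of_net {V : Type*} [NormedAddCommGroup V] [NormedSpace ℂ V] {s : Finset V}
    (hs : ∀ x : V, ‖x‖ ≤ 1 → ∃ p ∈ s, ‖x - p‖ ≤ 1 / 2) (φ : V →L[ℂ] ℂ) {β : ℝ} (hβ : 0 ≤ β)
    (h : ∀ p ∈ s, ‖φ p‖ ≤ β) : ‖φ‖ ≤ 2 * β := by
  have : ‖φ‖ ≤ β + ‖φ‖ / 2 := by
    refine φ.opNorm_le_of_unit_norm (by positivity) fun x hx => ?_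
    obtain ⟨p, hp, hxp⟩ := hs x hx.le
    calc ‖φ x‖ = ‖φ p + φ (x - p)‖ := by rw [← map_add, add_sub_cancel]
      _ ≤ β + ‖φ‖ * (1 / 2) :=
        (norm_add_le _ _).trans (add_le_add (h p hp) ((φ.le_opNorm _).trans (by gcongr)))
      _ = β + ‖φ‖ / 2 := by ring
  linarith

/-- The net bound for linear forms is used once in each argument, each time at the cost of a factor
`2`. -/
lemma norm_gramDefect_le_of_net {V F : Type*} [NormedAddCommGroup V] [InnerProductSpace ℂ V]
    [FiniteDimensional ℂ V] [NormedAddCommGroup F] [InnerProductSpace ℂ F] {s : Finset V}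
    (hs : ∀ x : V, ‖x‖ ≤ 1 → ∃ p ∈ s, ‖x - p‖ ≤ 1 / 2) (T : V →ₗ[ℂ] F) {β : ℝ} (hβ : 0 ≤ β)
    (h : ∀ p ∈ s, ∀ q ∈ s, ‖gramDefect T p q‖ ≤ β) (u v : V) :
    ‖gramDefect T u v‖ ≤ 4 * β * ‖u‖ * ‖v‖ := by
  have key : ∀ (u : V) {γ : ℝ}, 0 ≤ γ → (∀ p ∈ s, ‖gramDefect T u p‖ ≤ γ) →
      ∀ v, ‖gramDefect T u v‖ ≤ 2 * γ * ‖v‖ := by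
    intro u γ hγ h v
    have := opNorm_le_of_net hs (LinearMap.toContinuousLinearMap (gramDefectForm T u)) hγ h
    exact ((LinearMap.toContinuousLinearMap (gramDefectForm T u)).le_opNorm v).trans (by gcongr)
  have h1 : ∀ p ∈ s, ‖gramDefect T u p‖ ≤ 2 * β * ‖u‖ := fun p hp => by
    rw [gramDefect_comm]
    exact key p hβ (h p hp) u
  exact (key u (by positivity) h1 v).trans (le_of_eq (by ring))

/-! ### Modewise products -/

section Modewise

variable {d : ℕ}

lemma sum_prod_eq_prod_sum {κ : Fin d → ℕ} (f : ∀ l, Fin (κ l) → ℂ) :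
    ∑ k : (∀ l, Fin (κ l)), ∏ l, f l (k l) = ∏ l, ∑ a, f l a := by
  rw [Finset.prod_univ_sum, Fintype.piFinset_univ]

/-- `modeProducts A` as a linear map. -/
def modeMap {m n : Fin d → ℕ} (A : ∀ l, Matrix (Fin (m l)) (Fin (n l)) ℂ) :
    Tensor n →ₗ[ℂ] Tensor m where
  toFun := modeProducts A
  map_add' Z W := by
    ext i
    simp [modeProducts, mul_add, Finset.sum_add_distrib]
  map_smul' c Z := by
    ext i
    simp only [modeProducts, PiLp.smul_apply, smul_eq_mul, RingHom.id_apply, Finset.mul_sum]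
    exact Finset.sum_congr rfl fun k _ => by ring

lemma modeMap_apply {m n : Fin d → ℕ} (A : ∀ l, Matrix (Fin (m l)) (Fin (n l)) ℂ)
    (Z : Tensor n) (i : ∀ l, Fin (m l)) :
    modeMap A Z i = ∑ k : (∀ l : Fin d, Fin (n l)), (∏ l, A l (i l) (k l)) * Z k := rfl

lemma modeMap_modeMap {m n p : Fin d → ℕ} (A : ∀ l, Matrix (Fin (m l)) (Fin (n l)) ℂ)
    (B : ∀ l, Matrix (Fin (n l)) (Fin (p l)) ℂ) (Z : Tensor p) :
    modeMap A (modeMap B Z) = modeMap (fun l => A l * B l) Z := by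
  ext i
  simp only [modeMap_apply, Finset.mul_sum]
  rw [Finset.sum_comm]
  refine Finset.sum_congr rfl fun q _ => ?_
  simp only [← mul_assoc]
  rw [← Finset.sum_mul]
  congr 1
  simp only [← Finset.prod_mul_distrib, Matrix.mul_apply]
  exact sum_prod_eq_prod_sum fun l a => A l (i l) a * B l a (q l)

lemma toEuclideanLin_apply' {m n : ℕ} (A : Matrix (Fin m) (Fin n) ℂ)
    (x : EuclideanSpace ℂ (Fin n)) (i : Fin m) :
    A.toEuclideanLin x i = ∑ j, A i j * x j := by
  simp [Matrix.toLpLin_apply, Matrix.mulVec, dotProduct]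

lemma modeMap_rankOne {m n : Fin d → ℕ} (A : ∀ l, Matrix (Fin (m l)) (Fin (n l)) ℂ)
    (v : ∀ l, EuclideanSpace ℂ (Fin (n l))) :
    modeMap A (rankOne v) = rankOne fun l => (A l).toEuclideanLin (v l) := by
  ext i
  simp only [modeMap_apply, rankOne, ← Finset.prod_mul_distrib, toEuclideanLin_apply']
  exact sum_prod_eq_prod_sum fun l a => A l (i l) a * v l a

lemma inner_rankOne {n : Fin d → ℕ} (u v : ∀ l, EuclideanSpace ℂ (Fin (n l))) :
    inner ℂ (rankOne u) (rankOne v) = ∏ l, inner ℂ (u l) (v l) := by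
  simp only [PiLp.inner_apply, rankOne, RCLike.inner_apply, map_prod, ← Finset.prod_mul_distrib]
  exact sum_prod_eq_prod_sum fun l a => v l a * starRingEnd ℂ (u l a)

lemma norm_rankOne {n : Fin d → ℕ} (u : ∀ l, EuclideanSpace ℂ (Fin (n l)))
    (hu : ∀ l, ‖u l‖ = 1) : ‖rankOne u‖ = 1 := by
  have h : inner ℂ (rankOne u) (rankOne u) = (1 : ℂ) := by
    rw [inner_rankOne]
    exact Finset.prod_eq_one fun l _ => by rw [inner_self_eq_norm_sq_to_K, hu]; simp
  have h' : ‖rankOne u‖ ^ 2 = 1 := by rw [norm_sq_eq_re_inner (𝕜 := ℂ), h, RCLike.one_re]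
  exact (pow_eq_one_iff_of_nonneg (norm_nonneg _) two_ne_zero).1 h'

/-- The fibre of the tensor `Z` in the mode `l` through the index `i`. -/
def fiber {n : Fin d → ℕ} (Z : Tensor n) (l : Fin d) (i : ∀ l, Fin (n l)) :
    EuclideanSpace ℂ (Fin (n l)) :=
  WithLp.toLp 2 fun a => Z (Function.update i l a)

/-- Exchanging `a` with the entry `i l` is an involution on pairs. This allows fibres to be indexed
by full multi-indices, each fibre being counted `n l` times, without splitting off the mode `l`. -/
lemma sum_sum_update {n : Fin d → ℕ} (l : Fin d) (f : (∀ l, Fin (n l)) → ℝ) :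
    ∑ i, ∑ a, f (Function.update i l a) = n l * ∑ i, f i := by
  have e : Function.Involutive fun p : (∀ l, Fin (n l)) × Fin (n l) =>
      (Function.update p.1 l p.2, p.1 l) := by
    rintro ⟨i, a⟩
    simp
  calc ∑ i, ∑ a, f (Function.update i l a)
      = ∑ p : (∀ l, Fin (n l)) × Fin (n l), f (Function.update p.1 l p.2) := by
        rw [Fintype.sum_prod_type]
    _ = ∑ p : (∀ l, Fin (n l)) × Fin (n l), f p.1 :=
        Fintype.sum_equiv e.toPerm _ _ fun p => rfl
    _ = _ := by
        rw [Fintype.sum_prod_type]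
        simp [Finset.mul_sum]

lemma modeMap_update_one_apply {n : Fin d → ℕ} (l : Fin d) (A : Matrix (Fin (n l)) (Fin (n l)) ℂ)
    (Z : Tensor n) (i : ∀ l, Fin (n l)) :
    modeMap (Function.update (fun j => (1 : Matrix (Fin (n j)) (Fin (n j)) ℂ)) l A) Z i =
      A.toEuclideanLin (fiber Z l i) (i l) := by
  rw [modeMap_apply, toEuclideanLin_apply']
  symm
  refine Fintype.sum_of_injective (fun a => Function.update i l a) (Function.update_injective i l)
    _ _ (fun k hk => ?_) fun a => ?_
  · have : ∃ j, j ≠ l ∧ i j ≠ k j := by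
      by_contra! h
      refine hk ⟨k l, ?_⟩
      ext j
      rcases eq_or_ne j l with rfl | hj
      · simp
      · simp [hj, h j hj]
    obtain ⟨j, hj, hij⟩ := this
    rw [Finset.prod_eq_zero (Finset.mem_univ j), zero_mul]
    rw [Function.update_of_ne hj, Matrix.one_apply_ne hij]
  · rw [Finset.prod_eq_single l]
    · simp [fiber]
    · intro j _ hj
      rw [Function.update_of_ne hj, Function.update_of_ne hj, Matrix.one_apply_eq]
    · simp

lemma nearIsometryAt_modeMap_update_one {n : Fin d → ℕ} (l : Fin d)
    (A : Matrix (Fin (n l)) (Fin (n l)) ℂ) (Z : Tensor n) {ε : ℝ}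
    (h : ∀ i, NearIsometryAt A.toEuclideanLin ε (fiber Z l i)) :
    NearIsometryAt (modeMap
      (Function.update (fun j => (1 : Matrix (Fin (n j)) (Fin (n j)) ℂ)) l A)) ε Z := by
  set W := modeMap (Function.update (fun j => (1 : Matrix (Fin (n j)) (Fin (n j)) ℂ)) l A) Z with hW
  have h1 : n l * ‖Z‖ ^ 2 = ∑ i, ‖fiber Z l i‖ ^ 2 := by
    rw [EuclideanSpace.norm_sq_eq, ← sum_sum_update l]
    exact Finset.sum_congr rfl fun i _ => (EuclideanSpace.norm_sq_eq (fiber Z l i)).symm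
  have h2 : n l * ‖W‖ ^ 2 = ∑ i, ‖A.toEuclideanLin (fiber Z l i)‖ ^ 2 := by
    rw [EuclideanSpace.norm_sq_eq, ← sum_sum_update l]
    refine Finset.sum_congr rfl fun i _ => ?_
    rw [EuclideanSpace.norm_sq_eq]
    refine Finset.sum_congr rfl fun a _ => ?_
    rw [hW, modeMap_update_one_apply]
    simp [fiber]
  -- The factor `n l` can be cancelled only if it is positive, which a multi-index guarantees.
  rcases isEmpty_or_nonempty (∀ l, Fin (n l)) with hn | ⟨⟨i⟩⟩
  · have hZ : Z = 0 := by ext i; exact hn.elim i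
    simp [NearIsometryAt, hZ]
  · have hl : (0 : ℝ) < n l := by exact_mod_cast (Fin.pos (i l))
    have h3 : |n l * ‖W‖ ^ 2 - n l * ‖Z‖ ^ 2| ≤ ε * (n l * ‖Z‖ ^ 2) := by
      rw [h1, h2, ← Finset.sum_sub_distrib, Finset.mul_sum]
      exact (Finset.abs_sum_le_sum_abs _ _).trans (Finset.sum_le_sum fun i _ => h i)
    rw [← mul_sub, abs_mul, abs_of_pos hl] at h3
    rw [NearIsometryAt]
    nlinarith

/-- The first `t` matrices of the family `B`, and the identity in the other modes. -/
def firstModes {n : Fin d → ℕ} (B : ∀ l, Matrix (Fin (n l)) (Fin (n l)) ℂ) (t : ℕ) (l : Fin d) :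
    Matrix (Fin (n l)) (Fin (n l)) ℂ :=
  if (l : ℕ) < t then B l else 1

lemma modeMap_firstModes_succ {n : Fin d → ℕ} (B : ∀ l, Matrix (Fin (n l)) (Fin (n l)) ℂ)
    (l : Fin d) (Z : Tensor n) :
    modeMap (firstModes B (l + 1)) Z =
      modeMap (Function.update (fun j => (1 : Matrix (Fin (n j)) (Fin (n j)) ℂ)) l (B l))
        (modeMap (firstModes B l) Z) := by
  rw [modeMap_modeMap]
  congr 2
  ext1 j
  rcases eq_or_ne j l with rfl | hj
  · simp [firstModes]
  · rw [Function.update_of_ne hj, one_mul, firstModes, firstModes]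
    congr 1
    have : (j : ℕ) ≠ l := fun h => hj (Fin.ext h)
    simp only [eq_iff_iff]
    omega

lemma modeMap_one {n : Fin d → ℕ} (Z : Tensor n) :
    modeMap (fun j => (1 : Matrix (Fin (n j)) (Fin (n j)) ℂ)) Z = Z := by
  ext i
  rw [modeMap_apply, Finset.sum_eq_single i]
  · simp
  · intro k _ hk
    obtain ⟨j, hj⟩ := Function.ne_iff.1 hk
    have h0 : (1 : Matrix (Fin (n j)) (Fin (n j)) ℂ) (i j) (k j) = 0 := Matrix.one_apply_ne hj.symm
    exact mul_eq_zero_of_left (Finset.prod_eq_zero (Finset.mem_univ j) h0) _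
  · simp

/-- Successive control of the fibres gives control of the norm of the modewise product. -/
lemma nearIsometryAt_modeMap_of_fibers {n : Fin d → ℕ}
    (B : ∀ l, Matrix (Fin (n l)) (Fin (n l)) ℂ) (Z : Tensor n) {ε : ℝ} (hε : 0 ≤ ε)
    (h : ∀ (l : Fin d) i,
      NearIsometryAt (B l).toEuclideanLin ε (fiber (modeMap (firstModes B l) Z) l i)) :
    NearIsometryAt (modeMap B) ((1 + ε) ^ d - 1) Z := by
  have key : ∀ t ≤ d, NearIsometryAt (modeMap (firstModes B t)) ((1 + ε) ^ t - 1) Z := by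
    intro t
    induction t with
    | zero =>
      intro _
      have : firstModes B 0 = fun j => 1 := by ext1 j; simp [firstModes]
      simp [this, NearIsometryAt, modeMap_one]
    | succ t ih =>
      intro ht
      have h1 := ih (by omega)
      have h2 := nearIsometryAt_modeMap_update_one ⟨t, by omega⟩ _ _ (h ⟨t, by omega⟩)
      have h3 := modeMap_firstModes_succ B ⟨t, by omega⟩ Z
      simp only at h3
      rw [NearIsometryAt] at h1 h2 ⊢
      rw [← h3] at h2
      simp only at h2
      -- The new mode errs by `ε a`, relative to the already distorted tensor, whence the factor `1
      -- + ε` per mode.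
      set a := ‖modeMap (firstModes B t) Z‖ ^ 2
      have ha : a ≤ (1 + ε) ^ t * ‖Z‖ ^ 2 := by linarith [(abs_le.1 h1).2]
      have hb := mul_le_mul_of_nonneg_left ha hε
      calc _ ≤ _ := abs_sub_le _ a _
        _ ≤ ε * a + ((1 + ε) ^ t - 1) * ‖Z‖ ^ 2 := add_le_add h2 h1
        _ ≤ _ := by rw [pow_succ (1 + ε)]; linarith
  have := key d le_rfl
  rwa [show firstModes B d = B by ext1 j; simp [firstModes]] at this

/-- Add zero rows to an `m × n` matrix with `m ≤ n` to make it square. -/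
def padRows {m n : ℕ} (A : Matrix (Fin m) (Fin n) ℂ) : Matrix (Fin n) (Fin n) ℂ :=
  Matrix.of fun a b => if h : (a : ℕ) < m then A ⟨a, h⟩ b else 0

/-- Padding changes no norm, and with square matrices all partially compressed tensors live in the
same space. -/
lemma norm_toEuclideanLin_padRows {m n : ℕ} (hmn : m ≤ n) (A : Matrix (Fin m) (Fin n) ℂ)
    (x : EuclideanSpace ℂ (Fin n)) :
    ‖(padRows A).toEuclideanLin x‖ = ‖A.toEuclideanLin x‖ := by
  rw [← sq_eq_sq₀ (norm_nonneg _) (norm_nonneg _), EuclideanSpace.norm_sq_eq,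
    EuclideanSpace.norm_sq_eq]
  symm
  refine Fintype.sum_of_injective (Fin.castLE hmn) (Fin.castLE_injective hmn) _ _
    (fun k hk => ?_) fun a => ?_
  · have : ¬ (k : ℕ) < m := fun h => hk ⟨⟨k, h⟩, rfl⟩
    simp [toEuclideanLin_apply', padRows, this]
  · simp [toEuclideanLin_apply', padRows]

lemma norm_modeMap_padRows {m n : Fin d → ℕ} (hmn : ∀ l, m l ≤ n l)
    (A : ∀ l, Matrix (Fin (m l)) (Fin (n l)) ℂ) (Z : Tensor n) :
    ‖modeMap (fun l => padRows (A l)) Z‖ = ‖modeMap A Z‖ := by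
  rw [← sq_eq_sq₀ (norm_nonneg _) (norm_nonneg _), EuclideanSpace.norm_sq_eq,
    EuclideanSpace.norm_sq_eq]
  symm
  refine Fintype.sum_of_injective (fun (i : ∀ l, Fin (m l)) l => Fin.castLE (hmn l) (i l))
    (fun i j hij => funext fun l => Fin.castLE_injective (hmn l) (congrFun hij l)) _ _
    (fun k hk => ?_) fun a => ?_
  · have : ∃ l, ¬ (k l : ℕ) < m l := by
      by_contra! h
      exact hk ⟨fun l => ⟨k l, h l⟩, rfl⟩
    obtain ⟨l, hl⟩ := this
    rw [modeMap_apply, Finset.sum_eq_zero]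
    · simp
    · intro p _
      rw [Finset.prod_eq_zero (Finset.mem_univ l), zero_mul]
      simp [padRows, hl]
  · simp [modeMap_apply, padRows]

/-- `vect` as a linear isometry. -/
def vectIsometry (m : Fin d → ℕ) : Tensor m →ₗᵢ[ℂ] EuclideanSpace ℂ (Fin (∏ l, m l)) where
  toFun := vect
  map_add' _ _ := rfl
  map_smul' _ _ := rfl
  norm_map' Z := by
    rw [← sq_eq_sq₀ (norm_nonneg _) (norm_nonneg _), EuclideanSpace.norm_sq_eq,
      EuclideanSpace.norm_sq_eq]
    exact Fintype.sum_equiv finPiFinEquiv.symm _ _ fun a => rfl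

lemma norm_vect {m : Fin d → ℕ} (Z : Tensor m) : ‖vect Z‖ = ‖Z‖ := (vectIsometry m).norm_map Z

end Modewise

/-! ### Incoherent bases -/

/-- Expanding `∏ (b i + (a i - b i))`, the terms other than `∏ b i` are bounded by those of `(β + δ)
^ card` other than `β ^ card`. -/
lemma norm_prod_sub_prod_le {ι : Type*} (s : Finset ι) (a b : ι → ℂ) {β δ : ℝ} (hβ : 0 ≤ β)
    (hδ : 0 ≤ δ) (hb : ∀ i ∈ s, ‖b i‖ ≤ β) (hab : ∀ i ∈ s, ‖a i - b i‖ ≤ δ) :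
    ‖∏ i ∈ s, a i - ∏ i ∈ s, b i‖ ≤ (β + δ) ^ s.card - β ^ s.card := by
  classical
  induction s using Finset.induction_on with
  | empty => simp
  | insert i s hi ih =>
    rw [Finset.prod_insert hi, Finset.prod_insert hi, Finset.card_insert_of_notMem hi]
    have h1 := ih (fun j hj => hb j (Finset.mem_insert_of_mem hj))
      (fun j hj => hab j (Finset.mem_insert_of_mem hj))
    have h2 : ‖∏ j ∈ s, b j‖ ≤ β ^ s.card := by
      rw [norm_prod]
      exact (Finset.prod_le_prod (fun _ _ => norm_nonneg _) fun j hj =>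
        hb j (Finset.mem_insert_of_mem hj)).trans (by simp)
    have hai : ‖a i‖ ≤ β + δ := by
      have := norm_add_le (b i) (a i - b i)
      rw [add_sub_cancel] at this
      linarith [hb i (Finset.mem_insert_self _ _), hab i (Finset.mem_insert_self _ _)]
    calc ‖a i * ∏ j ∈ s, a j - b i * ∏ j ∈ s, b j‖
        = ‖a i * (∏ j ∈ s, a j - ∏ j ∈ s, b j) + (a i - b i) * ∏ j ∈ s, b j‖ := by ring_nf
      _ ≤ ‖a i‖ * ‖∏ j ∈ s, a j - ∏ j ∈ s, b j‖ + ‖a i - b i‖ * ‖∏ j ∈ s, b j‖ := by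
        rw [← norm_mul, ← norm_mul]; exact norm_add_le _ _
      _ ≤ (β + δ) * ((β + δ) ^ s.card - β ^ s.card) + δ * β ^ s.card := by
        gcongr
        exact hab i (Finset.mem_insert_self _ _)
      _ = _ := by ring

/-- The left side increases with `x`, and the right side is its value at `x = 1`. -/
lemma add_pow_sub_pow_le {x s : ℝ} (hx : 0 ≤ x) (hx1 : x ≤ 1) (hs : 0 ≤ s) (d : ℕ) :
    (x + s) ^ d - x ^ d ≤ (1 + s) ^ d - 1 := by
  induction d with
  | zero => simp
  | succ d ih =>
    have h1 : (x + s) ^ d ≤ (1 + s) ^ d := by gcongr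
    have h2 : x * ((x + s) ^ d - x ^ d) ≤ 1 * ((1 + s) ^ d - 1) := by
      refine mul_le_mul hx1 ih ?_ zero_le_one
      have : x ^ d ≤ (x + s) ^ d := by gcongr; linarith
      linarith
    have h3 := mul_le_mul_of_nonneg_left h1 hs
    rw [pow_succ, pow_succ, pow_succ]
    linarith

variable {d r : ℕ} {n : Fin d → ℕ}

lemma modewiseCoherence_nonneg (y : ∀ l : Fin d, Fin r → EuclideanSpace ℂ (Fin (n l))) :
    0 ≤ modewiseCoherence y := by
  apply Real.sSup_nonneg
  rintro _ ⟨l, k, h, -, rfl⟩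
  exact norm_nonneg _

lemma norm_inner_le_modewiseCoherence {y : ∀ l : Fin d, Fin r → EuclideanSpace ℂ (Fin (n l))}
    (hy : IsIncoherentBasis y) (l : Fin d) {k h : Fin r} (hkh : k ≠ h) :
    ‖inner ℂ (y l k) (y l h)‖ ≤ modewiseCoherence y := by
  refine le_csSup ⟨1, ?_⟩ ⟨l, k, h, hkh, rfl⟩
  rintro _ ⟨l, k, h, -, rfl⟩
  have := norm_inner_le_norm (𝕜 := ℂ) (y l k) (y l h)
  rwa [hy.norm_eq_one, hy.norm_eq_one, mul_one] at this

/-- The factor `r = R ^ d` demanded of the off-diagonal errors is absorbed one `R` per mode: `r ((μ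
+ δ) ^ d - μ ^ d) = (μ R + δ R) ^ d - (μ R) ^ d`, which is harmless because `μ R ≤ 1`. -/
lemma nearIsometryAt_modeMap_of_incoherent {m : Fin d → ℕ} (hd : 2 ≤ d) (hr : 1 ≤ r)
    {y : ∀ l : Fin d, Fin r → EuclideanSpace ℂ (Fin (n l))} (hy : IsIncoherentBasis y)
    (A : ∀ l, Matrix (Fin (m l)) (Fin (n l)) ℂ) {R s δ : ℝ} (hR : 1 ≤ R) (hRd : R ^ d = r)
    (hδ : 0 ≤ δ) (hs : δ * R ≤ s)
    (hA : ∀ l k h, ‖gramDefect (A l).toEuclideanLin (y l k) (y l h)‖ ≤ δ)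
    {Z : Tensor n} (hZ : Z ∈ spanOf y) :
    NearIsometryAt (modeMap A) (4 * ((1 + s) ^ d - 1)) Z := by
  set μ := modewiseCoherence y with hμ
  have hμ0 : 0 ≤ μ := modewiseCoherence_nonneg y
  have hr0 : (0 : ℝ) < r := by exact_mod_cast hr
  have hs0 : 0 ≤ s := le_trans (by positivity) hs
  have hδs : δ ≤ s := le_trans (le_mul_of_one_le_right hδ hR) hs
  obtain ⟨e, rfl⟩ : ∃ e, d = e + 1 := ⟨d - 1, by omega⟩
  have he : e ≠ 0 := by omega
  have hμe : r * μ ^ e < 1 / 2 := by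
    have := hy.coherence_lt
    rw [Nat.add_sub_cancel, lt_div_iff₀ (by positivity)] at this
    linarith
  -- Otherwise `1 < (μ R) ^ (d - 1) ≤ r μ ^ (d - 1) < 1/2`, using `R ^ (d - 1) ≤ R ^ d = r`.
  have hx : μ * R ≤ 1 := by
    by_contra! h
    have h1 : 1 < (μ * R) ^ e := one_lt_pow₀ h he
    rw [mul_pow] at h1
    have h2 : R ^ e ≤ r := by rw [← hRd]; exact pow_le_pow_right₀ hR (by omega)
    have := mul_le_mul_of_nonneg_left h2 (pow_nonneg hμ0 e)
    linarith
  have hμ1 : μ ≤ 1 := le_trans (le_mul_of_one_le_right hμ0 hR) hx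
  have gd : ∀ k h, gramDefect (modeMap A) (rankOne fun l => y l k) (rankOne fun l => y l h) =
      ∏ l, inner ℂ ((A l).toEuclideanLin (y l k)) ((A l).toEuclideanLin (y l h)) -
        ∏ l, inner ℂ (y l k) (y l h) := by
    intro k h
    rw [gramDefect, modeMap_rankOne, modeMap_rankOne, inner_rankOne, inner_rankOne]
  have hpow : (1 + δ) ^ (e + 1) ≤ (1 + s) ^ (e + 1) := by gcongr
  have hone : 1 ≤ (1 + s) ^ (e + 1) := one_le_pow₀ (by linarith)
  refine nearIsometryAt_of_mem_span (modeMap A) (fun k => rankOne fun l => y l k)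
    (G := μ ^ (e + 1)) hr (by positivity) (by linarith)
    (fun k => norm_rankOne _ fun l => hy.norm_eq_one l k) ?_ ?_ ?_ ?_ hZ
  · intro k h hkh
    rw [inner_rankOne, norm_prod]
    exact (Finset.prod_le_prod (fun _ _ => norm_nonneg _) fun l _ =>
      norm_inner_le_modewiseCoherence hy l hkh).trans (by simp [hμ])
  · rw [pow_succ]
    nlinarith [pow_nonneg hμ0 e]
  · intro k
    rw [gd]
    refine (norm_prod_sub_prod_le Finset.univ _ _ zero_le_one hδ
      (fun l _ => ?_) (fun l _ => hA l k k)).trans ?_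
    · rw [inner_self_eq_norm_sq_to_K, hy.norm_eq_one]; simp
    · rw [Finset.card_univ, Fintype.card_fin, one_pow]; linarith
  · intro k h hkh
    rw [gd]
    have h1 := norm_prod_sub_prod_le Finset.univ _ _ hμ0 hδ
      (fun l _ => norm_inner_le_modewiseCoherence hy l hkh) (fun l _ => hA l k h)
    rw [Finset.card_univ, Fintype.card_fin] at h1
    calc _ ≤ r * ((μ + δ) ^ (e + 1) - μ ^ (e + 1)) := mul_le_mul_of_nonneg_left h1 hr0.le
      _ = (μ * R + δ * R) ^ (e + 1) - (μ * R) ^ (e + 1) := by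
        rw [← hRd, ← add_mul, mul_pow, mul_pow]; ring
      _ ≤ (μ * R + s) ^ (e + 1) - (μ * R) ^ (e + 1) := by gcongr
      _ ≤ _ := add_pow_sub_pow_le (by positivity) hx hs0 _

/-! ### Probability of the good events -/

/-- Fubini in a single coordinate: a bound that holds for every choice of the other coordinates
holds for the product measure. -/
lemma measure_pi_le_of_update {ι : Type*} [Fintype ι] [DecidableEq ι] {Ω : ι → Type*}
    [∀ l, MeasurableSpace (Ω l)] (μ : ∀ l, Measure (Ω l)) [∀ l, IsProbabilityMeasure (μ l)]
    {S : Set (∀ l, Ω l)} (hS : MeasurableSet S) (l : ι) {p : ENNReal}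
    (h : ∀ ω : ∀ l, Ω l, μ l {a | Function.update ω l a ∈ S} ≤ p) :
    Measure.pi μ S ≤ p := by
  have hm : Measurable (S.indicator (1 : (∀ l, Ω l) → ENNReal)) := measurable_one.indicator hS
  have key : ∫⁻ ω, S.indicator 1 ω ∂Measure.pi μ ≤ ∫⁻ _, p ∂Measure.pi μ := by
    refine lintegral_le_of_lmarginal_le {l} hm measurable_const fun ω => ?_
    rw [lmarginal_singleton, lmarginal_singleton, lintegral_const, measure_univ, mul_one]
    refine le_trans (le_of_eq ?_) (h ω)
    exact lintegral_indicator_one ((measurable_update ω) hS)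
  rwa [lintegral_indicator_one hS, lintegral_const, measure_univ, mul_one] at key

lemma measure_prod_le_of_slice {α β : Type*} [MeasurableSpace α] [MeasurableSpace β]
    (μ : Measure α) (ν : Measure β) [IsProbabilityMeasure μ] [IsProbabilityMeasure ν]
    {S : Set (α × β)} (hS : MeasurableSet S) {p : ENNReal}
    (h : ∀ a, ν {b | (a, b) ∈ S} ≤ p) : μ.prod ν S ≤ p := by
  rw [Measure.prod_apply hS]
  refine (lintegral_mono fun a => h a).trans ?_
  rw [lintegral_const, measure_univ, mul_one]

instance (m n : ℕ) : SecondCountableTopology (Matrix (Fin m) (Fin n) ℂ) :=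
  inferInstanceAs (SecondCountableTopology (Fin m → Fin n → ℂ))

lemma _root_.Continuous.toEuclideanLin_apply {X : Type*} [TopologicalSpace X] {m n : ℕ}
    {f : X → Matrix (Fin m) (Fin n) ℂ} {g : X → EuclideanSpace ℂ (Fin n)} (hf : Continuous f)
    (hg : Continuous g) : Continuous fun x => (f x).toEuclideanLin (g x) :=
  (PiLp.continuous_toLp 2 _).comp (hf.matrix_mulVec ((PiLp.continuous_ofLp 2 _).comp hg))

lemma _root_.Continuous.modeMap_apply {X : Type*} [TopologicalSpace X] {d : ℕ} {m n : Fin d → ℕ}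
    {f : X → ∀ l, Matrix (Fin (m l)) (Fin (n l)) ℂ} {Z : Tensor n}
    (hf : ∀ l, Continuous fun x => f x l) : Continuous fun x => modeMap (f x) Z := by
  refine (PiLp.continuous_toLp 2 _).comp (continuous_pi fun i => ?_)
  refine continuous_finsetSum _ fun k _ => ?_
  refine (continuous_finsetProd _ fun l _ => ?_).mul continuous_const
  exact (hf l).matrix_elem (i l) (k l)

lemma _root_.Continuous.fiber {X : Type*} [TopologicalSpace X] {d : ℕ} {n : Fin d → ℕ}
    {f : X → Tensor n} (hf : Continuous f) (l : Fin d) (i : ∀ l, Fin (n l)) :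
    Continuous fun x => fiber (f x) l i := by
  refine (PiLp.continuous_toLp 2 _).comp (continuous_pi fun a => ?_)
  exact (PiLp.continuous_apply 2 _ _).comp hf

lemma isClosed_nearIsometryAt {X : Type*} [TopologicalSpace X] {m n : ℕ}
    {f : X → Matrix (Fin m) (Fin n) ℂ} {g : X → EuclideanSpace ℂ (Fin n)} (hf : Continuous f)
    (hg : Continuous g) (ε : ℝ) :
    IsClosed {x | NearIsometryAt (f x).toEuclideanLin ε (g x)} := by
  have := hf.toEuclideanLin_apply hg
  exact isClosed_le (by fun_prop) (by fun_prop)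

lemma isProbabilityMeasure_drawLaw {η K : ℝ} {D : MatrixLaws} (hD : IsOptimalJLFamily η K D)
    (m n : ℕ) : IsProbabilityMeasure (drawLaw D m n) := by
  unfold drawLaw
  split_ifs
  · exact hD.isProbabilityMeasure m n
  · infer_instance

/-- For `m = n` the drawn matrix is the identity and nothing can fail, so the cardinality condition
is needed only when `m < n`. -/
lemma drawLaw_not_nearIsometryAt_le {η K : ℝ} {D : MatrixLaws} (hD : IsOptimalJLFamily η K D)
    {m n : ℕ} (hmn : m ≤ n) {ε : ℝ} (hε : ε ∈ Set.Ioo (0 : ℝ) 1) {ι : Type*}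
    [Fintype ι] (x : ι → EuclideanSpace ℂ (Fin n))
    (hcard : m < n → (Fintype.card ι : ℝ) ≤ η * Real.exp (ε ^ 2 * m / K)) :
    drawLaw D m n {A | ∀ t, NearIsometryAt A.toEuclideanLin ε (x t)}ᶜ ≤ ENNReal.ofReal η := by
  classical
  have hprob := isProbabilityMeasure_drawLaw hD m n
  set G := {A : Matrix (Fin m) (Fin n) ℂ | ∀ t, NearIsometryAt A.toEuclideanLin ε (x t)} with hG
  rcases isEmpty_or_nonempty ι with he | hne
  · have : Gᶜ = ∅ := by simp [hG]
    simp [this]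
  have hGm : MeasurableSet G := by
    rw [hG, Set.ofPred_forall]
    exact (isClosed_iInter fun t =>
      isClosed_nearIsometryAt continuous_id continuous_const ε).measurableSet
  rcases hmn.lt_or_eq with hlt | rfl
  · have hjl := hD.jl ε hε m n hlt (Finset.univ.image x) (Finset.univ_nonempty.image x)
      (le_trans (by exact_mod_cast Finset.card_image_le) (hcard hlt))
    have hsub : {A | IsJLEmbedding ε A
        ((Finset.univ.image x : Finset _) : Set (EuclideanSpace ℂ (Fin n)))} ⊆ G := by
      intro A hA t
      obtain ⟨e, he, hx⟩ := hA (x t) (by simp)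
      rw [NearIsometryAt, hx, add_mul, one_mul, add_sub_cancel_left, abs_mul,
        abs_of_nonneg (sq_nonneg ‖x t‖)]
      exact mul_le_mul_of_nonneg_right (abs_lt.2 he).le (sq_nonneg _)
    have hd : drawLaw D m n = D m n := if_pos hlt
    rw [hd] at hprob ⊢
    have h2 : 1 - η ≤ (D m n).real G := hjl.trans (measureReal_mono hsub)
    rw [← ofReal_measureReal]
    refine ENNReal.ofReal_le_ofReal ?_
    rw [probReal_compl_eq_one_sub hGm]
    linarith
  · have hd : drawLaw D m m = Measure.dirac 1 := by
      rw [drawLaw, if_neg (lt_irrefl m)]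
      congr 1
      ext i j
      simp [Matrix.one_apply, Fin.ext_iff]
    have h1 : (1 : Matrix (Fin m) (Fin m) ℂ) ∈ G := by
      intro t
      have hε0 := hε.1.le
      have : (1 : Matrix (Fin m) (Fin m) ℂ).toEuclideanLin (x t) = x t := by
        simp
      rw [NearIsometryAt, this, sub_self, abs_zero]
      positivity
    rw [hd]
    rw [mem_ae_iff.1 ((mem_ae_dirac_iff hGm).2 h1)]
    exact zero_le

variable {m : Fin d → ℕ}

/-- The points that the `l`-th matrix has to preserve, given the matrices of the other modes. -/
def modePoints {ι : Type*} (y : ∀ l : Fin d, Fin r → EuclideanSpace ℂ (Fin (n l)))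
    (W : ι → Tensor n) (l : Fin d) (A : ∀ l : Fin d, Matrix (Fin (m l)) (Fin (n l)) ℂ) :
    (Fin r × Fin r × Fin 4) ⊕ (ι × ∀ l, Fin (n l)) → EuclideanSpace ℂ (Fin (n l))
  | .inl (k, h, s) => y l k + Complex.I ^ (s : ℕ) • y l h
  | .inr (t, i) => fiber (modeMap (firstModes (fun j => padRows (A j)) l) (W t)) l i

/-- Only matrices of modes before `l` enter, so given the other matrices the points for `A_l` are
fixed and the JL property of its law applies. -/
lemma modePoints_update {ι : Type*} (y : ∀ l : Fin d, Fin r → EuclideanSpace ℂ (Fin (n l)))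
    (W : ι → Tensor n) (l : Fin d) (A : ∀ l : Fin d, Matrix (Fin (m l)) (Fin (n l)) ℂ)
    (a : Matrix (Fin (m l)) (Fin (n l)) ℂ) :
    modePoints y W l (Function.update A l a) = modePoints y W l A := by
  have : firstModes (fun j => padRows (Function.update A l a j)) l =
      firstModes (fun j => padRows (A j)) l := by
    ext1 j
    unfold firstModes
    split_ifs with h
    · have hj : j ≠ l := fun e => by rw [e] at h; exact lt_irrefl _ h
      simp only [Function.update_of_ne hj]
    · rfl
  ext1 (⟨k, h, s⟩ | ⟨t, i⟩)
  · rfl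
  · simp only [modePoints, this]

lemma continuous_padRows (m n : ℕ) :
    Continuous (padRows : Matrix (Fin m) (Fin n) ℂ → Matrix (Fin n) (Fin n) ℂ) := by
  refine continuous_matrix fun a b => ?_
  unfold padRows
  simp only [Matrix.of_apply]
  split_ifs with h
  · exact continuous_id.matrix_elem _ _
  · exact continuous_const

lemma continuous_modePoints {ι : Type*}
    (y : ∀ l : Fin d, Fin r → EuclideanSpace ℂ (Fin (n l))) (W : ι → Tensor n) (l : Fin d)
    (t : (Fin r × Fin r × Fin 4) ⊕ (ι × ∀ l, Fin (n l))) :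
    Continuous fun A : ∀ l : Fin d, Matrix (Fin (m l)) (Fin (n l)) ℂ => modePoints y W l A t := by
  rcases t with ⟨k, h, s⟩ | ⟨t, i⟩
  · exact continuous_const
  · refine Continuous.fiber (Continuous.modeMap_apply fun j => ?_) l i
    unfold firstModes
    split_ifs
    · exact (continuous_padRows _ _).comp (continuous_apply j)
    · exact continuous_const

/-- With high probability, the modewise matrices almost preserve the inner products of the
factors of the basis tensors, and the norms of finitely many tensors. -/
lemma pi_drawLaw_bad_le {ι : Type*} [Fintype ι] {η K : ℝ} {D : Fin d → MatrixLaws}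
    (hD : ∀ l, IsOptimalJLFamily η K (D l)) (hmn : ∀ l, m l ≤ n l) {δ : ℝ}
    (hδ : δ ∈ Set.Ioo (0 : ℝ) 1) (y : ∀ l : Fin d, Fin r → EuclideanSpace ℂ (Fin (n l)))
    (W : ι → Tensor n)
    (hcard : ∀ l, m l < n l →
      4 * (r : ℝ) ^ 2 + Fintype.card ι * ((∏ l, n l : ℕ) : ℝ) ≤ η * Real.exp (δ ^ 2 * m l / K)) :
    (Measure.pi fun l => drawLaw (D l) (m l) (n l))
      {A | (∀ l k h, ‖gramDefect (A l).toEuclideanLin (y l k) (y l h)‖ ≤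
          δ * (‖y l k‖ ^ 2 + ‖y l h‖ ^ 2)) ∧
        ∀ t, NearIsometryAt (modeMap A) ((1 + δ) ^ d - 1) (W t)}ᶜ ≤ d * ENNReal.ofReal η := by
  have hprob : ∀ l, IsProbabilityMeasure (drawLaw (D l) (m l) (n l)) := fun l =>
    isProbabilityMeasure_drawLaw (hD l) _ _
  set S : ∀ l : Fin d, Set (∀ l : Fin d, Matrix (Fin (m l)) (Fin (n l)) ℂ) := fun l =>
    {A | ∀ t, NearIsometryAt (A l).toEuclideanLin δ (modePoints y W l A t)} with hS
  have hSm : ∀ l, MeasurableSet (S l) := by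
    intro l
    simp only [hS]
    rw [Set.ofPred_forall]
    exact (isClosed_iInter fun t => isClosed_nearIsometryAt (continuous_apply l)
      (continuous_modePoints y W l t) δ).measurableSet
  have hSP : ∀ l, (Measure.pi fun l => drawLaw (D l) (m l) (n l)) (S l)ᶜ ≤ ENNReal.ofReal η := by
    intro l
    refine measure_pi_le_of_update _ (hSm l).compl l fun A => ?_
    have e : {a | Function.update A l a ∈ (S l)ᶜ} =
        {a | ∀ t, NearIsometryAt a.toEuclideanLin δ (modePoints y W l A t)}ᶜ := by
      ext a
      simp only [hS, Set.mem_compl_iff, Set.mem_ofPred_eq, modePoints_update,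
        Function.update_self]
    rw [e]
    -- There are `4 r²` polarization points and at most `∏ n l` fibres for each tensor `W t`.
    refine drawLaw_not_nearIsometryAt_le (hD l) (hmn l) hδ _ fun hlt => ?_
    refine le_trans (le_of_eq ?_) (hcard l hlt)
    simp only [Fintype.card_sum, Fintype.card_prod, Fintype.card_fin, Fintype.card_pi]
    push_cast
    ring
  have hsub : {A : ∀ l : Fin d, Matrix (Fin (m l)) (Fin (n l)) ℂ |
      (∀ l k h, ‖gramDefect (A l).toEuclideanLin (y l k) (y l h)‖ ≤
          δ * (‖y l k‖ ^ 2 + ‖y l h‖ ^ 2)) ∧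
        ∀ t, NearIsometryAt (modeMap A) ((1 + δ) ^ d - 1) (W t)}ᶜ ⊆ ⋃ l, (S l)ᶜ := by
    intro A hA
    rw [← Set.compl_iInter]
    refine fun hmem => hA ⟨fun l k h => ?_, fun t => ?_⟩
    · exact norm_gramDefect_le _ _ _ fun s => (Set.mem_iInter.1 hmem l) (.inl (k, h, s))
    · have := nearIsometryAt_modeMap_of_fibers (fun j => padRows (A j)) (W t) hδ.1.le
        fun l i => by
          rw [NearIsometryAt, norm_toEuclideanLin_padRows (hmn l)]
          exact (Set.mem_iInter.1 hmem l) (.inr (t, i))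
      rwa [NearIsometryAt, norm_modeMap_padRows hmn] at this
  calc _ ≤ _ := measure_mono hsub
    _ ≤ ∑ l, (Measure.pi fun l => drawLaw (D l) (m l) (n l)) (S l)ᶜ :=
      measure_iUnion_fintype_le _ _
    _ ≤ ∑ _ : Fin d, ENNReal.ofReal η := Finset.sum_le_sum fun l _ => hSP l
    _ = _ := by simp

/-- Polarization gives `2 ε` on pairs of net points of norm at most one; passing from the net to all
vectors multiplies this by `4`. -/
lemma nearIsometryAt_of_net {V F : Type*} [NormedAddCommGroup V] [InnerProductSpace ℂ V]
    [FiniteDimensional ℂ V] [NormedAddCommGroup F] [InnerProductSpace ℂ F] {s : Finset V} {ε : ℝ}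
    (hε : 0 ≤ ε) (hs1 : ∀ p ∈ s, ‖p‖ ≤ 1)
    (hs : ∀ x : V, ‖x‖ ≤ 1 → ∃ p ∈ s, ‖x - p‖ ≤ 1 / 2) (T : V →ₗ[ℂ] F)
    (h : ∀ p ∈ s, ∀ q ∈ s, ∀ t : Fin 4, NearIsometryAt T ε (p + Complex.I ^ (t : ℕ) • q))
    (z : V) : NearIsometryAt T (8 * ε) z := by
  have h1 : ∀ p ∈ s, ∀ q ∈ s, ‖gramDefect T p q‖ ≤ 2 * ε := by
    intro p hp q hq
    have := norm_gramDefect_le T p q (h p hp q hq)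
    have hp1 : ‖p‖ ^ 2 ≤ 1 := pow_le_one₀ (norm_nonneg _) (hs1 p hp)
    have hq1 : ‖q‖ ^ 2 ≤ 1 := pow_le_one₀ (norm_nonneg _) (hs1 q hq)
    nlinarith
  have h2 := norm_gramDefect_le_of_net hs T (by linarith) h1 z z
  rw [norm_gramDefect_self] at h2
  exact h2.trans (le_of_eq (by ring))

lemma nearIsometryAt_comp_subtype {E F : Type*} [NormedAddCommGroup E] [InnerProductSpace ℂ E]
    [NormedAddCommGroup F] [InnerProductSpace ℂ F] (T : E →ₗ[ℂ] F) (U : Submodule ℂ E) (ε : ℝ)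
    (z : U) : NearIsometryAt (T.comp U.subtype) ε z ↔ NearIsometryAt T ε (z : E) := Iff.rfl

/-- A matrix drawn from an optimal family is nearly isometric on a subspace. -/
lemma drawLaw_subspace_bad_le {η K : ℝ} {D : MatrixLaws} (hD : IsOptimalJLFamily η K D) {m N : ℕ} (hmN : m ≤ N) {ε : ℝ} (hε : ε ∈ Set.Ioo (0 : ℝ) 1)
    {q : ℕ} (U : Submodule ℂ (EuclideanSpace ℂ (Fin N))) (hU : Module.finrank ℂ U ≤ q)
    (hcard : m < N → 4 * (625 : ℝ) ^ q ≤ η * Real.exp (ε ^ 2 * m / K)) :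
    drawLaw D m N {A | ∀ z ∈ U, NearIsometryAt A.toEuclideanLin (8 * ε) z}ᶜ ≤
      ENNReal.ofReal η := by
  obtain ⟨s, hcs, hs1, hs⟩ := exists_finset_net U
  -- The points are pairs of net points with four phases: `4 · (25 ^ q)² = 4 · 625 ^ q`.
  have key := drawLaw_not_nearIsometryAt_le hD hmN hε
    (fun t : s × s × Fin 4 => ((t.1 : U) + Complex.I ^ (t.2.2 : ℕ) • (t.2.1 : U) : U).1)
    fun hlt => by
      refine le_trans ?_ (hcard hlt)
      simp only [Fintype.card_prod, Fintype.card_fin, Fintype.card_coe]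
      have h1 : (s.card : ℝ) ≤ 25 ^ q := by
        have : s.card ≤ 25 ^ q := hcs.trans (Nat.pow_le_pow_right (by norm_num) hU)
        exact_mod_cast this
      have h2 : (625 : ℝ) ^ q = 25 ^ q * 25 ^ q := by rw [← mul_pow]; norm_num
      push_cast
      rw [h2]
      have := mul_le_mul h1 h1 (Nat.cast_nonneg _) (by positivity)
      linarith
  refine le_trans (measure_mono ?_) key
  refine Set.compl_subset_compl.2 fun A hA z hz => ?_
  refine (nearIsometryAt_comp_subtype A.toEuclideanLin U (8 * ε) ⟨z, hz⟩).1
    (nearIsometryAt_of_net hε.1.le hs1 hs _ (fun p hp q hq t => ?_) _)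
  exact (nearIsometryAt_comp_subtype A.toEuclideanLin U ε _).2 (hA (⟨p, hp⟩, ⟨q, hq⟩, t))

/-- Once the modewise matrices are fixed, the image of `V` is a fixed subspace of dimension at most
`q`, and the last matrix is independent of it. -/
lemma prod_drawLaw_bad_le {η K : ℝ} {D : MatrixLaws} (hD : IsOptimalJLFamily η K D)
    (P : Measure (∀ l : Fin d, Matrix (Fin (m l)) (Fin (n l)) ℂ)) [IsProbabilityMeasure P]
    {m' : ℕ} (hm' : m' ≤ ∏ l, m l) {ε : ℝ} (hε : ε ∈ Set.Ioo (0 : ℝ) 1)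
    {q : ℕ} (V : Submodule ℂ (Tensor n)) (hV : Module.finrank ℂ V ≤ q)
    (hcard : m' < ∏ l, m l → 4 * (625 : ℝ) ^ q ≤ η * Real.exp (ε ^ 2 * m' / K)) :
    (P.prod (drawLaw D m' (∏ l, m l)))
      {A | ∀ Z ∈ V, NearIsometryAt A.2.toEuclideanLin (8 * ε) (vect (modeMap A.1 Z))}ᶜ ≤
      ENNReal.ofReal η := by
  have hprob := isProbabilityMeasure_drawLaw hD m' (∏ l, m l)
  refine measure_prod_le_of_slice _ _ (MeasurableSet.compl ?_) fun A => ?_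
  · have : {A : (∀ l : Fin d, Matrix (Fin (m l)) (Fin (n l)) ℂ) × Matrix (Fin m') _ ℂ |
        ∀ Z ∈ V, NearIsometryAt A.2.toEuclideanLin (8 * ε) (vect (modeMap A.1 Z))} =
        ⋂ Z ∈ V, {A | NearIsometryAt A.2.toEuclideanLin (8 * ε) (vect (modeMap A.1 Z))} := by
      ext A; simp
    rw [this]
    refine (isClosed_biInter fun Z _ => ?_).measurableSet
    refine isClosed_nearIsometryAt continuous_snd ?_ _
    exact (vectIsometry m).continuous.comp
      (Continuous.modeMap_apply fun l => (continuous_apply l).comp continuous_fst)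
  · set U := V.map ((vectIsometry m).toLinearMap.comp (modeMap A))
    refine le_trans (measure_mono ?_) (drawLaw_subspace_bad_le hD hm' hε U
      ((Submodule.finrank_map_le _ _).trans hV) hcard)
    intro B hB hB'
    exact hB fun Z hZ => hB' _ (Submodule.mem_map_of_mem hZ)

/-! ### Arbitrary tensors -/

/-- A unit vector `w` (or zero), and its combinations with the vectors of a family `b`. -/
def crossPoints {E : Type*} [AddCommGroup E] [Module ℂ E] {ι : Type*} (w : E) (b : ι → E) :
    Option (ι × Fin 4) → E
  | none => w
  | some (k, s) => w + Complex.I ^ (s : ℕ) • b k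

/-- The defect at `w + Z` is expanded by sesquilinearity. The cross term is at most `2 τ √card · ‖w‖
‖Z‖` by Cauchy–Schwarz in the orthonormal basis, and it occurs twice; orthogonality gives `2 ‖w‖ ‖Z‖
≤ ‖w + Z‖²`. -/
lemma nearIsometryAt_add_of_mem_orthogonal {E F : Type*} [NormedAddCommGroup E]
    [InnerProductSpace ℂ E] [NormedAddCommGroup F] [InnerProductSpace ℂ F] (T : E →ₗ[ℂ] F)
    (V : Submodule ℂ E) {ι : Type*} [Fintype ι] (b : OrthonormalBasis ι ℂ V) {w : E} (hw : w ∈ Vᗮ)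
    {a τ : ℝ} (ha : 0 ≤ a) (hτ : 0 ≤ τ) (hV : ∀ Z ∈ V, NearIsometryAt T a Z)
    (hT : ∀ t, NearIsometryAt T τ (crossPoints ((‖w‖⁻¹ : ℂ) • w) (fun k => (b k : E)) t))
    {Z : E} (hZ : Z ∈ V) :
    NearIsometryAt T (a + τ + 2 * τ * √(Fintype.card ι)) (w + Z) := by
  -- The polarization bound is not homogeneous, so `w` is scaled to the length of the basis vectors.
  -- For `w = 0` the convention `0⁻¹ = 0` gives `u = 0`.
  set u : E := (‖w‖⁻¹ : ℂ) • w with hu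
  have hwu : w = (‖w‖ : ℂ) • u := by
    rcases eq_or_ne w 0 with rfl | h0
    · simp
    · rw [hu, smul_smul, mul_inv_cancel₀ (by simpa using h0), one_smul]
  have hu1 : ‖u‖ ≤ 1 := by
    rw [hu, norm_smul, norm_inv, Complex.norm_real, norm_norm]
    exact inv_mul_le_one
  have hb : ∀ k, ‖(b k : E)‖ = 1 := fun k => by
    rw [← Submodule.coe_norm]; exact b.orthonormal.norm_eq_one k
  have hcross : ∀ k, ‖gramDefect T u (b k)‖ ≤ 2 * τ := by
    intro k
    have := norm_gramDefect_le T u (b k) fun s => hT (some (k, s))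
    rw [hb] at this
    have hu2 : ‖u‖ ^ 2 ≤ 1 := pow_le_one₀ (norm_nonneg _) hu1
    nlinarith
  have hww : |‖T w‖ ^ 2 - ‖w‖ ^ 2| ≤ τ * ‖w‖ ^ 2 := by
    have h0 : ‖gramDefect T u u‖ ≤ τ := by
      rw [norm_gramDefect_self]
      refine (hT none).trans (mul_le_of_le_one_right hτ ?_)
      exact pow_le_one₀ (norm_nonneg _) hu1
    rw [← norm_gramDefect_self, hwu, gramDefect_smul_left, gramDefect_smul_right, ← hwu, norm_mul,
      norm_mul, RCLike.norm_conj, Complex.norm_real, norm_norm]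
    nlinarith [mul_le_mul_of_nonneg_left h0 (sq_nonneg ‖w‖)]
  have hwZ : ‖gramDefect T w Z‖ ≤ ‖w‖ * (2 * τ * (√(Fintype.card ι) * ‖Z‖)) := by
    have hexp : Z = ∑ k, b.repr ⟨Z, hZ⟩ k • (b k : E) := by
      have := congrArg Subtype.val (b.sum_repr ⟨Z, hZ⟩)
      rw [Submodule.coe_sum] at this
      exact this.symm
    have hnorm : √(∑ k, ‖b.repr ⟨Z, hZ⟩ k‖ ^ 2) = ‖Z‖ := by
      rw [← EuclideanSpace.norm_eq, LinearIsometryEquiv.norm_map]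
      rfl
    have := norm_gramDefect_sum_le T u (b.repr ⟨Z, hZ⟩) (fun k => (b k : E)) hcross
      (by linarith)
    rw [hnorm, ← hexp] at this
    rw [hwu, gramDefect_smul_left, ← hwu, norm_mul, RCLike.norm_conj, Complex.norm_real, norm_norm]
    gcongr
  have horth : ‖w + Z‖ ^ 2 = ‖w‖ ^ 2 + ‖Z‖ ^ 2 := by
    have := norm_add_sq (𝕜 := ℂ) w Z
    rw [Submodule.inner_left_of_mem_orthogonal hZ hw] at this
    simpa using this
  rw [NearIsometryAt, ← norm_gramDefect_self, gramDefect_add_left, gramDefect_add_right,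
    gramDefect_add_right, horth]
  have h1 := hV Z hZ
  rw [NearIsometryAt, ← norm_gramDefect_self] at h1
  rw [← norm_gramDefect_self] at hww
  have h2 := norm_add_le (gramDefect T w w + gramDefect T w Z)
    (gramDefect T Z w + gramDefect T Z Z)
  have h3 := norm_add_le (gramDefect T w w) (gramDefect T w Z)
  have h4 := norm_add_le (gramDefect T Z w) (gramDefect T Z Z)
  rw [gramDefect_comm T Z w] at h4
  have h5 : 2 * (‖w‖ * (2 * τ * (√(Fintype.card ι) * ‖Z‖))) ≤
      2 * τ * √(Fintype.card ι) * (‖w‖ ^ 2 + ‖Z‖ ^ 2) := by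
    have : 0 ≤ 2 * τ * √(Fintype.card ι) * (‖w‖ - ‖Z‖) ^ 2 := by positivity
    nlinarith
  have h6 : 0 ≤ τ * ‖Z‖ ^ 2 := by positivity
  have h7 : 0 ≤ a * ‖w‖ ^ 2 := by positivity
  linarith

/-! ### Assembling the sketch -/

/-- The hypothesis `hdet` isolates the deterministic part, which differs between the two cases. The
failure probabilities add up to `d · η / (4 d) + η / 2 < η`. -/
lemma one_sub_le_sketchLaw_goodEvent {ι : Type*} [Fintype ι] {η K ε δ : ℝ} {m' : ℕ}
    {D : Fin d → MatrixLaws} {D' : MatrixLaws} (hd : 1 ≤ d)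
    (hη : η ∈ Set.Ioo (0 : ℝ) (1 / 2)) (hε : ε ∈ Set.Ioo (0 : ℝ) (1 / 2))
    (hδ : δ ∈ Set.Ioo (0 : ℝ) 1)
    (hD : ∀ l, IsOptimalJLFamily (η / (4 * d)) K (D l)) (hD' : IsOptimalJLFamily (η / 2) K D')
    (hmn : ∀ l, m l ≤ n l) (hm' : m' ≤ ∏ l, m l)
    (y : ∀ l : Fin d, Fin r → EuclideanSpace ℂ (Fin (n l))) (hy : IsIncoherentBasis y)
    (X : Tensor n) (W : ι → Tensor n)
    (hcard : ∀ l, m l < n l → 4 * (r : ℝ) ^ 2 + Fintype.card ι * ((∏ l, n l : ℕ) : ℝ) ≤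
      η / (4 * d) * Real.exp (δ ^ 2 * m l / K))
    (hcard' : m' < ∏ l, m l →
      4 * (625 : ℝ) ^ (r + 1) ≤ η / 2 * Real.exp ((ε / 32) ^ 2 * m' / K))
    (hdet : ∀ A : ∀ l, Matrix (Fin (m l)) (Fin (n l)) ℂ,
      (∀ l k h, ‖gramDefect (A l).toEuclideanLin (y l k) (y l h)‖ ≤ 2 * δ) →
      (∀ t, NearIsometryAt (modeMap A) ((1 + δ) ^ d - 1) (W t)) →
      ∀ Y ∈ spanOf y, NearIsometryAt (modeMap A) (ε / 2) (X - Y)) :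
    1 - η ≤ (sketchLaw m n m' D D').real (goodEvent m m' ε X (spanOf y)) := by
  have hη0 := hη.1
  have hd0 : (0 : ℝ) < d := by exact_mod_cast hd
  have hp1 : ∀ l, IsProbabilityMeasure (drawLaw (D l) (m l) (n l)) := fun l =>
    isProbabilityMeasure_drawLaw (hD l) _ _
  have hp2 := isProbabilityMeasure_drawLaw hD' m' (∏ l, m l)
  set P := Measure.pi fun l => drawLaw (D l) (m l) (n l) with hP
  -- This space contains every `X - Y` and does not depend on the random matrices.
  set V : Submodule ℂ (Tensor n) := spanOf y ⊔ Submodule.span ℂ {X} with hVdef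
  have hV : Module.finrank ℂ V ≤ r + 1 := by
    refine (Submodule.finrank_add_le_finrank_add_finrank _ _).trans (add_le_add ?_ ?_)
    · exact (finrank_range_le_card _).trans (by simp)
    · exact (finrank_span_le_card ({X} : Set (Tensor n))).trans (by simp)
  have b1 := pi_drawLaw_bad_le hD hmn hδ y W hcard
  have b2 := prod_drawLaw_bad_le (n := n) hD' P hm'
    (show ε / 32 ∈ Set.Ioo (0 : ℝ) 1 from ⟨by linarith [hε.1], by linarith [hε.2]⟩) V hV hcard'
  rw [← hP] at b1
  set G1 := {A : ∀ l, Matrix (Fin (m l)) (Fin (n l)) ℂ |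
    (∀ l k h, ‖gramDefect (A l).toEuclideanLin (y l k) (y l h)‖ ≤
      δ * (‖y l k‖ ^ 2 + ‖y l h‖ ^ 2)) ∧
    ∀ t, NearIsometryAt (modeMap A) ((1 + δ) ^ d - 1) (W t)} with hG1
  set G2 := {A : (∀ l : Fin d, Matrix (Fin (m l)) (Fin (n l)) ℂ) ×
      Matrix (Fin m') (Fin (∏ l, m l)) ℂ |
    ∀ Z ∈ V, NearIsometryAt A.2.toEuclideanLin (8 * (ε / 32)) (vect (modeMap A.1 Z))} with hG2
  have hlaw : sketchLaw m n m' D D' = P.prod (drawLaw D' m' (∏ l, m l)) := rfl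
  have hsub : (goodEvent m m' ε X (spanOf y))ᶜ ⊆ (G1ᶜ ×ˢ Set.univ) ∪ G2ᶜ := by
    intro A hA
    by_contra hcon
    rw [Set.mem_union, not_or] at hcon
    obtain ⟨hA1, hA2⟩ := hcon
    rw [Set.mem_prod, not_and_or, Set.notMem_compl_iff] at hA1
    rw [Set.notMem_compl_iff] at hA2
    replace hA1 := hA1.resolve_right (by simp)
    refine hA fun Y hY => ?_
    have h1 := hdet A.1 (fun l k h => (hA1.1 l k h).trans (le_of_eq (by
      rw [hy.norm_eq_one, hy.norm_eq_one]; ring))) hA1.2 Y hY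
    have h2 := hA2 (X - Y) (sub_mem (Submodule.mem_sup_right (Submodule.mem_span_singleton_self X))
      (Submodule.mem_sup_left hY))
    rw [NearIsometryAt] at h1 h2
    rw [norm_vect] at h2
    change |‖A.2.toEuclideanLin (vect (modeMap A.1 (X - Y)))‖ ^ 2 - ‖X - Y‖ ^ 2| ≤ _
    set a := ‖X - Y‖ ^ 2
    have ha : 0 ≤ a := sq_nonneg _
    set b := ‖modeMap A.1 (X - Y)‖ ^ 2
    have hb : b ≤ (1 + ε / 2) * a := by linarith [(abs_le.1 h1).2]
    have h3 := mul_le_mul_of_nonneg_left hb (show 0 ≤ 8 * (ε / 32) by linarith [hε.1])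
    -- The two stages combine to `(ε / 4) (1 + ε / 2) + ε / 2 ≤ ε`.
    refine (abs_sub_le _ b _).trans ((add_le_add h2 h1).trans ?_)
    nlinarith [mul_nonneg ha hε.1.le, mul_nonneg (mul_nonneg ha hε.1.le) (sub_pos.2 hε.2).le]
  have hbad : (sketchLaw m n m' D D') (goodEvent m m' ε X (spanOf y))ᶜ ≤ ENNReal.ofReal η := by
    rw [hlaw]
    calc _ ≤ _ := measure_mono hsub
      _ ≤ _ := measure_union_le _ _
      _ ≤ d * ENNReal.ofReal (η / (4 * d)) + ENNReal.ofReal (η / 2) := by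
        refine add_le_add ?_ b2
        rw [Measure.prod_prod, measure_univ, mul_one]
        exact b1
      _ = ENNReal.ofReal (d * (η / (4 * d)) + η / 2) := by
        rw [ENNReal.ofReal_add (by positivity) (by positivity),
          ENNReal.ofReal_mul (Nat.cast_nonneg _), ENNReal.ofReal_natCast]
      _ ≤ ENNReal.ofReal η := by
        refine ENNReal.ofReal_le_ofReal ?_
        have : (d : ℝ) * (η / (4 * d)) = η / 4 := by field_simp
        linarith
  have hp : IsProbabilityMeasure (sketchLaw m n m' D D') := by rw [hlaw]; infer_instance
  -- Subadditivity on the event and its complement avoids measurability of the good event.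
  have h1 := measureReal_union_le (μ := sketchLaw m n m' D D')
    (goodEvent m m' ε X (spanOf y)) (goodEvent m m' ε X (spanOf y))ᶜ
  rw [Set.union_compl_self, probReal_univ] at h1
  have h2 : (sketchLaw m n m' D D').real (goodEvent m m' ε X (spanOf y))ᶜ ≤ η :=
    ENNReal.toReal_le_of_le_ofReal hη0.le hbad
  linarith

lemma one_add_pow_sub_one_le {δ : ℝ} (hδ : 0 ≤ δ) (hdδ : d * δ ≤ 1) :
    (1 + δ) ^ d - 1 ≤ 2 * (d * δ) := by
  have h0 : 0 ≤ d * δ := by positivity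
  have h1 : (1 + δ) ^ d ≤ Real.exp (d * δ) := by
    rw [Real.exp_nat_mul]
    gcongr
    linarith [Real.add_one_le_exp δ]
  have h2 := Real.abs_exp_sub_one_sub_id_le (x := d * δ) (by rwa [abs_of_nonneg h0])
  nlinarith [(abs_le.1 h2).2]

lemma nearIsometryAt_modeMap_of_incoherent_of_le (hd : 2 ≤ d) (hr : 1 ≤ r) {ε δ R : ℝ}
    (hε : 0 < ε) (hε1 : ε < 1 / 2)
    {y : ∀ l : Fin d, Fin r → EuclideanSpace ℂ (Fin (n l))} (hy : IsIncoherentBasis y)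
    (A : ∀ l, Matrix (Fin (m l)) (Fin (n l)) ℂ) (hR : 1 ≤ R) (hRd : R ^ d = r)
    (hδ : 0 ≤ δ) (hδR : 64 * d * δ * R ≤ ε)
    (hA : ∀ l k h, ‖gramDefect (A l).toEuclideanLin (y l k) (y l h)‖ ≤ 2 * δ)
    {Z : Tensor n} (hZ : Z ∈ spanOf y) : NearIsometryAt (modeMap A) (ε / 4) Z := by
  have hd0 : (0 : ℝ) < d := by exact_mod_cast (by omega : 0 < d)
  -- With `s = ε / (32 d)` one has `(1 + s) ^ d - 1 ≤ ε / 16`, and the lemma multiplies this by `4`.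
  have h := nearIsometryAt_modeMap_of_incoherent (s := ε / (32 * d)) hd hr hy A hR hRd
    (by linarith) (by rw [le_div_iff₀ (by positivity)]; linarith) hA hZ
  refine h.trans (mul_le_mul_of_nonneg_right ?_ (sq_nonneg _))
  have e : d * (ε / (32 * d)) = ε / 32 := by field_simp
  have := one_add_pow_sub_one_le (d := d) (δ := ε / (32 * d)) (by positivity)
    (by rw [e]; linarith)
  rw [e] at this
  linarith

lemma one_sub_le_of_mem_span {η K ε δ R : ℝ} {m' : ℕ}
    {D : Fin d → MatrixLaws} {D' : MatrixLaws} (hd : 2 ≤ d) (hr : 1 ≤ r)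
    (hη : η ∈ Set.Ioo (0 : ℝ) (1 / 2)) (hε : ε ∈ Set.Ioo (0 : ℝ) (1 / 2))
    (hδ : δ ∈ Set.Ioo (0 : ℝ) 1) (hR : 1 ≤ R) (hRd : R ^ d = r) (hδR : 64 * d * δ * R ≤ ε)
    (hD : ∀ l, IsOptimalJLFamily (η / (4 * d)) K (D l)) (hD' : IsOptimalJLFamily (η / 2) K D')
    (hmn : ∀ l, m l ≤ n l) (hm' : m' ≤ ∏ l, m l)
    (y : ∀ l : Fin d, Fin r → EuclideanSpace ℂ (Fin (n l))) (hy : IsIncoherentBasis y)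
    (X : Tensor n) (hX : X ∈ spanOf y)
    (hcard : ∀ l, m l < n l → 4 * (r : ℝ) ^ 2 ≤ η / (4 * d) * Real.exp (δ ^ 2 * m l / K))
    (hcard' : m' < ∏ l, m l →
      4 * (625 : ℝ) ^ (r + 1) ≤ η / 2 * Real.exp ((ε / 32) ^ 2 * m' / K)) :
    1 - η ≤ (sketchLaw m n m' D D').real (goodEvent m m' ε X (spanOf y)) := by
  refine one_sub_le_sketchLaw_goodEvent (ι := Empty) (by omega) hη hε hδ hD hD' hmn hm' y hy X
    (fun t => t.elim) (fun l hl => by simpa using hcard l hl) hcard' fun A hA _ Y hY => ?_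
  refine (nearIsometryAt_modeMap_of_incoherent_of_le hd hr hε.1 hε.2 hy A hR hRd hδ.1.le hδR hA
    (sub_mem hX hY)).trans ?_
  gcongr
  · exact hε.1.le
  · norm_num

/-- The tensors to preserve are the `crossPoints` of the component of `X` orthogonal to the
subspace, at most `4 r + 1` of them. The factor `√r` in `hδr` pays for the cross terms. -/
lemma one_sub_le_of_arbitrary {η K ε δ : ℝ} {m' : ℕ}
    {D : Fin d → MatrixLaws} {D' : MatrixLaws} (hd : 2 ≤ d) (hr : 1 ≤ r)
    (hη : η ∈ Set.Ioo (0 : ℝ) (1 / 2)) (hε : ε ∈ Set.Ioo (0 : ℝ) (1 / 2))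
    (hδ : δ ∈ Set.Ioo (0 : ℝ) 1) (hδr : 64 * d * δ * √r ≤ ε)
    (hD : ∀ l, IsOptimalJLFamily (η / (4 * d)) K (D l)) (hD' : IsOptimalJLFamily (η / 2) K D')
    (hmn : ∀ l, m l ≤ n l) (hm' : m' ≤ ∏ l, m l)
    (y : ∀ l : Fin d, Fin r → EuclideanSpace ℂ (Fin (n l))) (hy : IsIncoherentBasis y)
    (X : Tensor n)
    (hcard : ∀ l, m l < n l → 4 * (r : ℝ) ^ 2 + (4 * r + 1) * ((∏ l, n l : ℕ) : ℝ) ≤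
      η / (4 * d) * Real.exp (δ ^ 2 * m l / K))
    (hcard' : m' < ∏ l, m l →
      4 * (625 : ℝ) ^ (r + 1) ≤ η / 2 * Real.exp ((ε / 32) ^ 2 * m' / K)) :
    1 - η ≤ (sketchLaw m n m' D D').real (goodEvent m m' ε X (spanOf y)) := by
  have hd0 : (0 : ℝ) < d := by exact_mod_cast (by omega : 0 < d)
  have hr1 : (1 : ℝ) ≤ r := by exact_mod_cast hr
  have hsr : 1 ≤ √(r : ℝ) := Real.one_le_sqrt.2 hr1
  obtain ⟨P, hP, w, hw, rfl⟩ := (spanOf y).exists_add_mem_mem_orthogonal X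
  have hfin : Module.finrank ℂ (spanOf y) ≤ r := (finrank_range_le_card _).trans (by simp)
  set b := stdOrthonormalBasis ℂ (spanOf y)
  refine one_sub_le_sketchLaw_goodEvent
    (ι := Option (Fin (Module.finrank ℂ (spanOf y)) × Fin 4)) (by omega) hη hε hδ hD hD' hmn hm'
    y hy _ (crossPoints ((‖w‖⁻¹ : ℂ) • w) fun k => (b k : Tensor n)) (fun l hl => ?_) hcard'
    fun A hA hW Y hY => ?_
  · refine le_trans ?_ (hcard l hl)
    gcongr
    simp only [Fintype.card_option, Fintype.card_prod, Fintype.card_fin]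
    push_cast
    have : (Module.finrank ℂ (spanOf y) : ℝ) ≤ r := by exact_mod_cast hfin
    linarith
  · set R : ℝ := (r : ℝ) ^ (1 / (d : ℝ)) with hR
    have hRd : R ^ d = r := by
      rw [hR, ← Real.rpow_natCast, ← Real.rpow_mul (by linarith), one_div_mul_cancel hd0.ne',
        Real.rpow_one]
    have hR1 : 1 ≤ R := Real.one_le_rpow hr1 (by positivity)
    -- As `d ≥ 2`, the smallness of `δ` relative to `√r` also covers what the incoherent span needs.
    have hRr : R ≤ √r := by
      rw [Real.sqrt_eq_rpow, hR]
      apply Real.rpow_le_rpow_of_exponent_le hr1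
      gcongr
      exact_mod_cast hd
    have hδ0 := hδ.1
    have hδR : 64 * d * δ * R ≤ ε := le_trans (by gcongr) hδr
    have hdδ : d * δ ≤ ε / (64 * √r) := by rw [le_div_iff₀ (by positivity)]; linarith
    have hle : ε / (64 * √r) ≤ ε / 64 := by
      apply div_le_div_of_nonneg_left hε.1.le (by norm_num); linarith
    have hτ := one_add_pow_sub_one_le hδ.1.le (d := d) (by linarith [hε.2])
    set τ := (1 + δ) ^ d - 1 with hτdef
    have hτ0 : 0 ≤ τ := by
      have : 1 ≤ (1 + δ) ^ d := one_le_pow₀ (by linarith)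
      linarith
    have hτ1 : τ ≤ ε / 32 := by linarith
    have hτ2 : τ * √(Fintype.card (Fin (Module.finrank ℂ (spanOf y)))) ≤ ε / 32 := by
      have hc : √(Fintype.card (Fin (Module.finrank ℂ (spanOf y))) : ℝ) ≤ √(r : ℝ) := by
        apply Real.sqrt_le_sqrt
        simpa using hfin
      calc _ ≤ 2 * (ε / (64 * √r)) * √r := by
            refine mul_le_mul (by linarith) hc (Real.sqrt_nonneg _) ?_
            have := hε.1
            positivity
        _ = ε / 32 := by field_simp; ring
    have := nearIsometryAt_add_of_mem_orthogonal (modeMap A) (spanOf y) b hw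
      (a := ε / 4) (by linarith [hε.1]) hτ0
      (fun Z hZ => nearIsometryAt_modeMap_of_incoherent_of_le hd hr hε.1 hε.2 hy A hR1 hRd hδ.1.le
        hδR hA hZ) hW (sub_mem hP hY)
    rw [show P + w - Y = w + (P - Y) by abel]
    refine this.trans (mul_le_mul_of_nonneg_right ?_ (sq_nonneg _))
    -- The error budget is `ε / 4 + ε / 32 + 2 · ε / 32 ≤ ε / 2`.
    linarith [hε.1]

/-! ### Choice of the dimensions -/

/-- Take the least integer satisfying the JL cardinality condition, cut off at `n`; if the cutoff is
active the matrix is the identity and no condition is required. The `+ 1` is the rounding. -/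
lemma exists_dimension {K δ N η : ℝ} (hK : 0 < K) (hδ : 0 < δ) (hN : 0 < N) (hη : 0 < η)
    {Λ : ℝ} (hΛ : 0 ≤ Λ) (h : Real.log (N / η) ≤ Λ) (n : ℕ) :
    ∃ m : ℕ, m ≤ n ∧ (m : ℝ) ≤ K / δ ^ 2 * Λ + 1 ∧
      (m < n → N ≤ η * Real.exp (δ ^ 2 * m / K)) := by
  have h0 : 0 ≤ K / δ ^ 2 * Λ := by positivity
  refine ⟨min n ⌈K / δ ^ 2 * Λ⌉₊, min_le_left _ _, ?_, fun hlt => ?_⟩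
  · exact le_trans (by exact_mod_cast min_le_right _ _) (Nat.ceil_lt_add_one h0).le
  · have hm : K / δ ^ 2 * Λ ≤ (min n ⌈K / δ ^ 2 * Λ⌉₊ : ℕ) := by
      rw [min_eq_right (by omega)]
      exact Nat.le_ceil _
    set m := min n ⌈K / δ ^ 2 * Λ⌉₊
    have h1 : Λ ≤ δ ^ 2 * m / K := by
      rw [le_div_iff₀ hK]
      have := mul_le_mul_of_nonneg_left hm (sq_nonneg δ)
      have e : δ ^ 2 * (K / δ ^ 2 * Λ) = Λ * K := by field_simp
      linarith
    rw [← div_le_iff₀' hη, ← Real.exp_log (show 0 < N / η by positivity)]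
    exact Real.exp_le_exp.2 (h.trans h1)

lemma one_le_log {x : ℝ} (hx : 3 ≤ x) : 1 ≤ Real.log x := by
  rw [Real.le_log_iff_exp_le (by linarith)]
  linarith [Real.exp_one_lt_d9]

lemma rpow_one_div_mem_Ioc {η : ℝ} (hη : η ∈ Set.Ioo (0 : ℝ) (1 / 2)) (k : ℕ) :
    η ^ (1 / (k : ℝ)) ∈ Set.Ioc (0 : ℝ) 1 :=
  ⟨Real.rpow_pos_of_pos hη.1 _,
    Real.rpow_le_one hη.1.le (by linarith [hη.2]) (by positivity)⟩

lemma rpow_one_div_pow {x : ℝ} (hx : 0 ≤ x) {k : ℕ} (hk : k ≠ 0) :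
    (x ^ (1 / (k : ℝ))) ^ k = x := by
  rw [one_div, Real.rpow_inv_natCast_pow hx hk]

/-- The dimension of the last reduction. -/
lemma exists_last_dimension {K ε η : ℝ} (hK : 0 < K) (hr : 1 ≤ r)
    (hη : η ∈ Set.Ioo (0 : ℝ) (1 / 2)) (hε : ε ∈ Set.Ioo (0 : ℝ) (1 / 2)) (M : ℕ) :
    ∃ m' : ℕ, m' ≤ M ∧
      (m' : ℝ) ≤ (4096 * K + 1) * r * (ε ^ 2)⁻¹ * Real.log (47 / (ε * η ^ (1 / (r : ℝ)))) ∧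
      (m' < M → 4 * (625 : ℝ) ^ (r + 1) ≤ η / 2 * Real.exp ((ε / 32) ^ 2 * m' / K)) := by
  have hε0 := hε.1
  have hη0 := hη.1
  have hr1 : (1 : ℝ) ≤ r := by exact_mod_cast hr
  obtain ⟨hp0, hp1⟩ := rpow_one_div_mem_Ioc hη r
  have hpr := rpow_one_div_pow hη.1.le (k := r) (by omega)
  set p := η ^ (1 / (r : ℝ))
  set x := 47 / (ε * p) with hx
  have hx94 : 94 / p ≤ x := by
    rw [hx, div_le_div_iff₀ hp0 (by positivity)]
    nlinarith [hε.2]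
  have hx94' : 94 ≤ x := le_trans (by rw [le_div_iff₀ hp0]; linarith) hx94
  have hlog := one_le_log (x := x) (by linarith)
  -- Since `ε < 1/2`, `x` exceeds `94 / η ^ (1 / r)`, and its power `4 r` beats `8 · 625 ^ (r + 1) /
  -- η`. The constant is then `4 · 32² = 4096`.
  have hN : Real.log (4 * (625 : ℝ) ^ (r + 1) / (η / 2)) ≤ 4 * r * Real.log x := by
    rw [show (4 * r * Real.log x : ℝ) = ((4 * r : ℕ) : ℝ) * Real.log x by push_cast; ring,
      ← Real.log_pow]
    apply Real.log_le_log (by positivity)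
    have hη4 : η ^ 4 ≤ η := by
      calc η ^ 4 ≤ η ^ 1 := pow_le_pow_of_le_one hη0.le (by linarith [hη.2]) (by norm_num)
        _ = η := pow_one _
    calc 4 * (625 : ℝ) ^ (r + 1) / (η / 2) = 8 * 625 ^ (r + 1) / η := by field_simp; norm_num
      _ ≤ 94 ^ (4 * r) / η := by
        gcongr
        calc (8 : ℝ) * 625 ^ (r + 1) ≤ 8 ^ r * 625 ^ (2 * r) := by
              gcongr
              · exact le_self_pow₀ (by norm_num) (by omega)
              · norm_num
              · omega
          _ = 3125000 ^ r := by rw [pow_mul, ← mul_pow]; norm_num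
          _ ≤ (94 ^ 4) ^ r := by gcongr; norm_num
          _ = 94 ^ (4 * r) := by rw [pow_mul]
      _ ≤ 94 ^ (4 * r) / η ^ 4 := by gcongr
      _ = (94 / p) ^ (4 * r) := by
        rw [div_pow, mul_comm 4 r, pow_mul p, hpr]
      _ ≤ x ^ (4 * r) := by gcongr
  obtain ⟨m', h1, h2, h3⟩ := exists_dimension hK (δ := ε / 32) (by linarith)
    (by positivity) (show 0 < η / 2 by linarith) (by positivity) hN M
  refine ⟨m', h1, h2.trans ?_, h3⟩
  have e : K / (ε / 32) ^ 2 * (4 * r * Real.log x) = 4096 * K * r * (ε ^ 2)⁻¹ * Real.log x := by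
    field_simp; norm_num
  have hε2 : 1 ≤ (ε ^ 2)⁻¹ := by
    rw [one_le_inv₀ (by positivity)]; nlinarith [hε.2]
  have h4 : 1 ≤ r * (ε ^ 2)⁻¹ * Real.log x :=
    one_le_mul_of_one_le_of_one_le (one_le_mul_of_one_le_of_one_le hr1 hε2) hlog
  rw [e]
  linarith

/-- The assumption `4 r + 1 ≤ ν` lets powers of `ν` absorb `r`, and `d ≥ 3` enters through `2 d + 3
≤ 3 d`. The exponent `3 d` contributes one factor `d` to the `d ^ 3` of the dimension bound; the
other two come from `δ⁻²`. -/
lemma card_bound_arbitrary {ν : ℕ} (hd : 3 ≤ d) (hr : 1 ≤ r) (hν : 4 * r + 1 ≤ ν)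
    (hn : ∀ l, n l ≤ ν) :
    4 * d * (4 * (r : ℝ) ^ 2 + (4 * r + 1) * ((∏ l, n l : ℕ) : ℝ)) ≤ (ν : ℝ) ^ (3 * d) := by
  have hprod : ∏ l, n l ≤ ν ^ d :=
    (Finset.prod_le_pow_card _ _ _ fun l _ => hn l).trans (by simp)
  have h1 : 4 * d * (4 * r ^ 2 + (4 * r + 1) * ∏ l, n l) ≤ ν ^ (3 * d) := by
    have a1 : 4 * r ^ 2 ≤ ν ^ (d + 1) := by
      calc 4 * r ^ 2 ≤ (4 * r + 1) ^ 2 := by nlinarith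
        _ ≤ ν ^ 2 := Nat.pow_le_pow_left hν 2
        _ ≤ ν ^ (d + 1) := Nat.pow_le_pow_right (by omega) (by omega)
    have a2 : (4 * r + 1) * ∏ l, n l ≤ ν ^ (d + 1) := by
      rw [pow_succ']; exact Nat.mul_le_mul hν hprod
    have a3 : d ≤ ν ^ d := (Nat.lt_two_pow_self).le.trans (Nat.pow_le_pow_left (by omega) d)
    have a4 : 8 ≤ ν ^ 2 := by nlinarith
    calc 4 * d * (4 * r ^ 2 + (4 * r + 1) * ∏ l, n l)
        ≤ 4 * d * (ν ^ (d + 1) + ν ^ (d + 1)) := Nat.mul_le_mul_left _ (Nat.add_le_add a1 a2)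
      _ = 8 * d * ν ^ (d + 1) := by ring
      _ ≤ ν ^ 2 * ν ^ d * ν ^ (d + 1) :=
        Nat.mul_le_mul_right _ (Nat.mul_le_mul a4 a3)
      _ = ν ^ (2 * d + 3) := by ring
      _ ≤ ν ^ (3 * d) := Nat.pow_le_pow_right (by omega) (by omega)
  exact_mod_cast h1

/-- The dimensions of the modewise reductions for arbitrary tensors. -/
lemma exists_mode_dimensions_arbitrary {K ε η : ℝ} {ν : ℕ} (hK : 0 < K) (hd : 3 ≤ d) (hr : 1 ≤ r)
    (hη : η ∈ Set.Ioo (0 : ℝ) (1 / 2)) (hε : ε ∈ Set.Ioo (0 : ℝ) (1 / 2)) (hν : 4 * r + 1 ≤ ν)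
    (hn : ∀ l, n l ≤ ν) :
    ∃ m : Fin d → ℕ, ∀ l, m l ≤ n l ∧
      (m l : ℝ) ≤ (12288 * K + 1) * (r * (d : ℝ) ^ 3 / ε ^ 2) *
        Real.log (ν / η ^ (1 / (d : ℝ))) ∧
      (m l < n l → 4 * (r : ℝ) ^ 2 + (4 * r + 1) * ((∏ l, n l : ℕ) : ℝ) ≤
        η / (4 * d) * Real.exp ((ε / (64 * d * √r)) ^ 2 * m l / K)) := by
  have hε0 := hε.1
  have hη0 := hη.1
  have hr1 : (1 : ℝ) ≤ r := by exact_mod_cast hr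
  have hd3 : (3 : ℝ) ≤ d := by exact_mod_cast hd
  have hν5 : (5 : ℝ) ≤ ν := by exact_mod_cast (by omega : 5 ≤ ν)
  obtain ⟨hp0, hp1⟩ := rpow_one_div_mem_Ioc hη d
  have hpd := rpow_one_div_pow hη.1.le (k := d) (by omega)
  set p := η ^ (1 / (d : ℝ))
  have hx : (ν : ℝ) ≤ ν / p := by
    rw [le_div_iff₀ hp0]; nlinarith
  have hlog := one_le_log (x := ν / p) (by linarith)
  set Λ := Real.log (ν / p) with hΛ
  set N : ℝ := 4 * (r : ℝ) ^ 2 + (4 * r + 1) * ((∏ l, n l : ℕ) : ℝ) with hN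
  have hN0 : 0 < N := by positivity
  have hNΛ : Real.log (N / (η / (4 * d))) ≤ 3 * d * Λ := by
    rw [show (3 * d * Λ : ℝ) = ((3 * d : ℕ) : ℝ) * Λ by push_cast; ring, hΛ, ← Real.log_pow]
    apply Real.log_le_log (by positivity)
    have hη3 : η ^ 3 ≤ η := by
      calc η ^ 3 ≤ η ^ 1 := pow_le_pow_of_le_one hη0.le (by linarith [hη.2]) (by norm_num)
        _ = η := pow_one _
    calc N / (η / (4 * d)) = 4 * d * N / η := by field_simp
      _ ≤ (ν : ℝ) ^ (3 * d) / η ^ 3 := by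
        gcongr
        exact card_bound_arbitrary hd hr hν hn
      _ = _ := by rw [div_pow, mul_comm 3 d, pow_mul p, hpd]
  have key := fun l => exists_dimension hK (δ := ε / (64 * d * √r)) (by positivity) hN0
    (show 0 < η / (4 * d) by positivity) (by positivity) hNΛ (n l)
  choose m h1 h2 h3 using key
  refine ⟨m, fun l => ⟨h1 l, (h2 l).trans ?_, h3 l⟩⟩
  have e : K / (ε / (64 * d * √r)) ^ 2 * (3 * d * Λ) =
      12288 * K * (r * (d : ℝ) ^ 3 / ε ^ 2) * Λ := by
    have hs : √(r : ℝ) ^ 2 = r := Real.sq_sqrt (by linarith)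
    rw [div_pow, mul_pow, mul_pow, hs]
    field_simp
    norm_num
  have h4 : 1 ≤ r * (d : ℝ) ^ 3 / ε ^ 2 := by
    rw [le_div_iff₀ (by positivity), one_mul]
    calc ε ^ 2 ≤ 1 := pow_le_one₀ hε0.le (by linarith [hε.2])
      _ ≤ r * (d : ℝ) ^ 3 :=
        one_le_mul_of_one_le_of_one_le hr1 (one_le_pow₀ (by linarith))
  have h5 := one_le_mul_of_one_le_of_one_le h4 hlog
  rw [e]
  linarith

/-- The dimensions of the modewise reductions for tensors in the subspace. -/
lemma exists_mode_dimensions_span {K ε η : ℝ} (n : Fin d → ℕ) (hK : 0 < K) (hd : 3 ≤ d)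
    (hr : 1 ≤ r) (hη : η ∈ Set.Ioo (0 : ℝ) (1 / 2)) (hε : ε ∈ Set.Ioo (0 : ℝ) (1 / 2)) :
    ∃ m : Fin d → ℕ, ∀ l, m l ≤ n l ∧
      (m l : ℝ) ≤ (8192 * K + 1) * ((r : ℝ) ^ (2 / (d : ℝ)) * (d / ε) ^ 2) *
        Real.log (2 * (r : ℝ) ^ 2 * d / η) ∧
      (m l < n l → 4 * (r : ℝ) ^ 2 ≤
        η / (4 * d) * Real.exp ((ε / (64 * d * (r : ℝ) ^ (1 / (d : ℝ)))) ^ 2 * m l / K)) := by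
  have hε0 := hε.1
  have hη0 := hη.1
  have hr1 : (1 : ℝ) ≤ r := by exact_mod_cast hr
  have hd3 : (3 : ℝ) ≤ d := by exact_mod_cast hd
  have hR1 : 1 ≤ (r : ℝ) ^ (1 / (d : ℝ)) := Real.one_le_rpow hr1 (by positivity)
  have hR2 : (r : ℝ) ^ (2 / (d : ℝ)) = ((r : ℝ) ^ (1 / (d : ℝ))) ^ 2 := by
    rw [← Real.rpow_natCast, ← Real.rpow_mul (by linarith)]
    congr 1
    push_cast
    ring
  rw [hR2]
  set R := (r : ℝ) ^ (1 / (d : ℝ))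
  set x := 2 * (r : ℝ) ^ 2 * d / η with hx
  have hx12 : 12 ≤ x := by
    rw [hx, le_div_iff₀ hη0]
    nlinarith [hη.2, one_le_pow₀ hr1 (n := 2)]
  have hlog := one_le_log (x := x) (by linarith)
  -- The argument is `8 x`, and `8 x ≤ x²` because `x ≥ 12`.
  have hN : Real.log (4 * (r : ℝ) ^ 2 / (η / (4 * d))) ≤ 2 * Real.log x := by
    rw [show (2 * Real.log x : ℝ) = ((2 : ℕ) : ℝ) * Real.log x by push_cast; ring, ← Real.log_pow]
    apply Real.log_le_log (by positivity)
    have : 4 * (r : ℝ) ^ 2 / (η / (4 * d)) = 8 * x := by rw [hx]; field_simp; norm_num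
    rw [this]
    nlinarith
  have key := fun l => exists_dimension hK (δ := ε / (64 * d * R)) (by positivity)
    (by positivity) (show 0 < η / (4 * d) by positivity) (by positivity) hN (n l)
  choose m h1 h2 h3 using key
  refine ⟨m, fun l => ⟨h1 l, (h2 l).trans ?_, h3 l⟩⟩
  have e : K / (ε / (64 * d * R)) ^ 2 * (2 * Real.log x) =
      8192 * K * (R ^ 2 * (d / ε) ^ 2) * Real.log x := by
    field_simp
    norm_num
  have h4 : 1 ≤ R ^ 2 * (d / ε) ^ 2 := by
    refine one_le_mul_of_one_le_of_one_le (one_le_pow₀ hR1) (one_le_pow₀ ?_)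
    rw [le_div_iff₀ hε0]
    linarith [hε.2]
  have h5 := one_le_mul_of_one_le_of_one_le h4 hlog
  rw [e]
  linarith

lemma prod_natCast_le_pow {m : Fin d → ℕ} {B : ℝ} (h : ∀ l, (m l : ℝ) ≤ B) :
    ((∏ l, m l : ℕ) : ℝ) ≤ B ^ d := by
  push_cast
  exact (Finset.prod_le_prod (fun _ _ => Nat.cast_nonneg _) fun l _ => h l).trans (by simp)

end TensorJL
end

/-! ### The theorem: choice of constants and assembly -/

theorem theorem1 :
    -- optimal families exist, with one absolute constant for all `η`
    (∃ K : ℝ, 0 < K ∧ ∀ η ∈ Set.Ioo (0 : ℝ) (1 / 2), ∃ D : TensorJL.MatrixLaws,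
      TensorJL.IsOptimalJLFamily η K D) ∧
    -- any independent matrices from such families can be used
    ∀ K : ℝ, 0 < K → ∃ C' C Ct : ℝ, 0 < C' ∧ 0 < C ∧ 0 < Ct ∧
      ∀ ε ∈ Set.Ioo (0 : ℝ) (1 / 2), ∀ η ∈ Set.Ioo (0 : ℝ) (1 / 2),
      ∀ d : ℕ, 3 ≤ d → ∀ (r : ℕ), 1 ≤ r → ∀ (n : Fin d → ℕ),
        -- arbitrary `X`
        (4 * r + 1 ≤ Finset.univ.sup n →
          ∃ (m : Fin d → ℕ) (m' : ℕ), (∀ l, m l ≤ n l) ∧ m' ≤ ∏ l, m l ∧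
            (m' : ℝ) ≤ C' * r * (ε ^ 2)⁻¹ * Real.log (47 / (ε * η ^ (1 / (r : ℝ)))) ∧
            (∀ l, (m l : ℝ) ≤ C * (r * (d : ℝ) ^ 3 / ε ^ 2) *
              Real.log (((Finset.univ.sup n : ℕ) : ℝ) / η ^ (1 / (d : ℝ)))) ∧
            ((∏ l, m l : ℕ) : ℝ) ≤ C ^ d * ((r : ℝ) ^ d * (d : ℝ) ^ (3 * d) / ε ^ (2 * d)) *
              Real.log (((Finset.univ.sup n : ℕ) : ℝ) / η ^ (1 / (d : ℝ))) ^ d ∧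
            ∀ (D : Fin d → TensorJL.MatrixLaws) (D' : TensorJL.MatrixLaws),
              (∀ l, TensorJL.IsOptimalJLFamily (η / (4 * d)) K (D l)) →
              TensorJL.IsOptimalJLFamily (η / 2) K D' →
              ∀ y : (∀ l : Fin d, Fin r → EuclideanSpace ℂ (Fin (n l))),
                TensorJL.IsIncoherentBasis y → ∀ X : TensorJL.Tensor n,
                  1 - η ≤ (TensorJL.sketchLaw m n m' D D').real
                    (TensorJL.goodEvent m m' ε X (TensorJL.spanOf y))) ∧
        -- `X` in the subspace
        (∃ (m : Fin d → ℕ) (m' : ℕ), (∀ l, m l ≤ n l) ∧ m' ≤ ∏ l, m l ∧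
            (m' : ℝ) ≤ C' * r * (ε ^ 2)⁻¹ * Real.log (47 / (ε * η ^ (1 / (r : ℝ)))) ∧
            (∀ l, (m l : ℝ) ≤ Ct * ((r : ℝ) ^ (2 / (d : ℝ)) * (d / ε) ^ 2) *
              Real.log (2 * (r : ℝ) ^ 2 * d / η)) ∧
            ((∏ l, m l : ℕ) : ℝ) ≤ Ct ^ d * ((r : ℝ) ^ 2 * (d / ε) ^ (2 * d)) *
              Real.log (2 * (r : ℝ) ^ 2 * d / η) ^ d ∧
            ∀ (D : Fin d → TensorJL.MatrixLaws) (D' : TensorJL.MatrixLaws),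
              (∀ l, TensorJL.IsOptimalJLFamily (η / (4 * d)) K (D l)) →
              TensorJL.IsOptimalJLFamily (η / 2) K D' →
              ∀ y : (∀ l : Fin d, Fin r → EuclideanSpace ℂ (Fin (n l))),
                TensorJL.IsIncoherentBasis y → ∀ X ∈ TensorJL.spanOf y,
                  1 - η ≤ (TensorJL.sketchLaw m n m' D D').real
                    (TensorJL.goodEvent m m' ε X (TensorJL.spanOf y))) := by
  refine ⟨TensorJL.exists_isOptimalJLFamily, fun K hK => ⟨4096 * K + 1, 12288 * K + 1,
    8192 * K + 1, by positivity, by positivity, by positivity, ?_⟩⟩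
  intro ε hε η hη d hd r hr n
  have hε0 := hε.1
  have hr1 : (1 : ℝ) ≤ r := by exact_mod_cast hr
  have hd3 : (3 : ℝ) ≤ d := by exact_mod_cast hd
  -- The per-mode error is `δ = ε / (64 d R)`, with `R = √r` for arbitrary `X` and `R = r ^ (1 / d)`
  -- for `X` in the subspace.
  have hIoo : ∀ R : ℝ, 1 ≤ R → ε / (64 * d * R) ∈ Set.Ioo (0 : ℝ) 1 := by
    intro R hR
    refine ⟨by positivity, ?_⟩
    rw [div_lt_one (by positivity)]
    nlinarith [hε.2]
  have hle : ∀ R : ℝ, 1 ≤ R → 64 * d * (ε / (64 * d * R)) * R ≤ ε := by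
    intro R hR
    exact le_of_eq (by field_simp)
  constructor
  · intro hn
    obtain ⟨m, hm⟩ := TensorJL.exists_mode_dimensions_arbitrary (n := n) hK hd hr hη hε hn
      fun l => Finset.le_sup (Finset.mem_univ l)
    obtain ⟨m', hm1, hm2, hm3⟩ := TensorJL.exists_last_dimension hK hr hη hε (∏ l, m l)
    refine ⟨m, m', fun l => (hm l).1, hm1, hm2, fun l => (hm l).2.1, ?_, ?_⟩
    · refine (TensorJL.prod_natCast_le_pow fun l => (hm l).2.1).trans (le_of_eq ?_)
      simp only [mul_pow, div_pow, ← pow_mul]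
    · intro D D' hD hD' y hy X
      have hs : 1 ≤ √(r : ℝ) := Real.one_le_sqrt.2 hr1
      exact TensorJL.one_sub_le_of_arbitrary (by omega) hr hη hε (hIoo _ hs) (hle _ hs) hD hD'
        (fun l => (hm l).1) hm1 y hy X (fun l => (hm l).2.2) hm3
  · obtain ⟨m, hm⟩ := TensorJL.exists_mode_dimensions_span n hK hd hr hη hε
    obtain ⟨m', hm1, hm2, hm3⟩ := TensorJL.exists_last_dimension hK hr hη hε (∏ l, m l)
    refine ⟨m, m', fun l => (hm l).1, hm1, hm2, fun l => (hm l).2.1, ?_, ?_⟩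
    · refine (TensorJL.prod_natCast_le_pow fun l => (hm l).2.1).trans (le_of_eq ?_)
      have hR : ((r : ℝ) ^ (2 / (d : ℝ))) ^ d = (r : ℝ) ^ 2 := by
        rw [← Real.rpow_natCast, ← Real.rpow_mul (by linarith),
          div_mul_cancel₀ _ (by linarith), Real.rpow_two]
      rw [mul_pow, mul_pow, mul_pow, hR, ← pow_mul]
    · intro D D' hD hD' y hy X hX
      have hs : 1 ≤ (r : ℝ) ^ (1 / (d : ℝ)) := Real.one_le_rpow hr1 (by positivity)
      exact TensorJL.one_sub_le_of_mem_span (by omega) hr hη hε (hIoo _ hs) hs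
        (TensorJL.rpow_one_div_pow (by linarith) (by omega)) (hle _ hs) hD hD'
        (fun l => (hm l).1) hm1 y hy X hX (fun l => (hm l).2.2) hm3
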